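/- Let $q>0$, $\rho\ge 0$, $c\ge 0$. Packets $0,1,2,\dots$ are generated at a node at times $t_i=X_0+\dots+X_i$, where the $X_j\ge 0$ are i.i.d. exponential random variables with rate $q$. The node may also have private randomness $\mathcal R$ (a $\sigma$-algebra independent of $(X_j)_j$). A transmission policy $\pi$ assigns to each packet $i$ a transmission time $r_i\in[t_i,\infty]$ ($r_i=\infty$: never transmitted); transmitted packets are received instantaneously. The policy is causal if, for all $t$ and $i$, the event $\{r_i\le t\}$ is determined by $\mathcal R$ and the packet generations up to time $t$, i.e. belongs to $\mathcal F_t=\mathcal R\vee\sigma(\{t_j\le s\}: j\ge 0,\ s\le t)$. Let $R(t)=\#\{i: r_i\le t\}$, let $\lambda(t)$ be the largest generation time of a packet received by time $t$ ($\lambda(t)=0$ if there is none), let $\Delta(t)=t-\lambda(t)$ be the age of information, and put $$C_{av}^\pi(t)=\frac ct R(t),\qquad \Delta_{av}^\pi(t)=\frac1t\int_0^t\Delta(s)\,ds .$$ A policy is non-buffering if $r_i\in\{t_i,\infty\}$ for all $i$. The cycles of a non-buffering policy are the intervals between the generation times of consecutively transmitted packets, the first cycle starting at time $0$. A causal non-buffering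 policy is called stationary here if almost surely it transmits infinitely many packets and its cycle lengths $T_0,T_1,\dots$ are i.i.d. with finite mean; $T$ denotes a generic cycle length. Let $T^*=\sqrt{1/q^2+2\rho c}-1/q$, and let $\pi^*_{ON}$ be the threshold policy that in each cycle transmits, immediately upon its generation, the first packet that is generated more than $T^*$ time units after the start of the cycle, and transmits no other packet. Then: 1. $T^*\ge 0$, and $\pi^*_{ON}$ is a causal, non-buffering, stationary policy. 2. Almost surely, $\lim_{t\to\infty}\bigl(\rho\, C_{av}^{\pi^*_{ON}}(t)+\Delta_{av}^{\pi^*_{ON}}(t)\bigr)=\sqrt{1/q^2+2\rho c}$. 3. $\pi^*_{ON}$ is optimal among all causal policies: for every causal policy $\pi$, almost surely $\liminf_{t\to\infty}\bigl(\rho\, C_{av}^{\pi}(t)+\Delta_{av}^{\pi}(t)\bigr)\ge\sqrt{1/q^2+2\rho c}$. 4. Every cycle length of $\pi^*_{ON}$ is square integrable with mean $\sqrt{1/q^2+2\rho c}$ and variance $1/q^2$. 5. Among all stationary policies, $\pi^*_{ON}$ minimizes $$\frac{\mathrm{Var}_\pi(T)+2\rho c}{2\,\mathbb E_\pi[T]}+\frac{\mathbb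 E_\pi[T]}2$$ (read as $+\infty$ when $\mathrm{Var}_\pi(T)=\infty$), and the minimal value is $\sqrt{1/q^2+2\rho c}$. -/

import Mathlib

open MeasureTheory ProbabilityTheory Filter Topology
open scoped ENNReal

namespace AoI

noncomputable section

variable {Ω : Type*}

/-- Generation time of packet `i` (packets are indexed from `0`), when `X i` is the time between
the generation of packet `i` and that of the previous packet (time `0` for `i = 0`). -/
def genTime (X : ℕ → Ω → ℝ) (i : ℕ) (ω : Ω) : ℝ :=
  ∑ j ∈ Finset.range (i + 1), X j ω

theorem measurable_genTime [MeasurableSpace Ω] {X : ℕ → Ω → ℝ} (hX : ∀ i, Measurable (X i))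
    (i : ℕ) : Measurable (genTime X i) :=
  Finset.measurable_fun_sum _ fun j _ => hX j

/-- The information available at time `t`: the private randomness `𝓡` of the node, and the packet
generations that have occurred by time `t`, i.e. all events `{packet i is generated by time s}`
with `s ≤ t`. -/
def infoFiltration (𝓡 : MeasurableSpace Ω) [mΩ : MeasurableSpace Ω] (h𝓡 : 𝓡 ≤ mΩ)
    (X : ℕ → Ω → ℝ) (hX : ∀ i, Measurable (X i)) : Filtration ℝ mΩ where
  seq t := 𝓡 ⊔ MeasurableSpace.generateFrom
    {A : Set Ω | ∃ i : ℕ, ∃ s : ℝ, s ≤ t ∧ A = {ω | genTime X i ω ≤ s}}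
  mono' := by
    intro t t' htt'
    refine sup_le_sup le_rfl (MeasurableSpace.generateFrom_mono ?_)
    rintro A ⟨i, s, hs, rfl⟩
    exact ⟨i, s, hs.trans htt', rfl⟩
  le' := by
    intro t
    refine sup_le h𝓡 (MeasurableSpace.generateFrom_le ?_)
    rintro A ⟨i, s, -, rfl⟩
    exact measurableSet_le (measurable_genTime hX i) measurable_const

/-- A transmission policy is described by the times `r i ω` at which packet `i` is transmitted
(and instantaneously received), `r i ω = ⊤` meaning that packet `i` is never transmitted. It is
causal if no packet is transmitted before its generation and, at each time `t`, the information
available at time `t` determines which packets have been transmitted by time `t`. -/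
def IsCausal (𝓡 : MeasurableSpace Ω) [mΩ : MeasurableSpace Ω] (h𝓡 : 𝓡 ≤ mΩ)
    (X : ℕ → Ω → ℝ) (hX : ∀ i, Measurable (X i)) (r : ℕ → Ω → WithTop ℝ) : Prop :=
  (∀ i ω, (genTime X i ω : WithTop ℝ) ≤ r i ω) ∧
    ∀ i, IsStoppingTime (infoFiltration 𝓡 h𝓡 X hX) (r i)

/-- Each packet is either transmitted immediately when it is generated, or never. -/
def IsNonBuffering (X : ℕ → Ω → ℝ) (r : ℕ → Ω → WithTop ℝ) : Prop :=
  ∀ i ω, r i ω = (genTime X i ω : WithTop ℝ) ∨ r i ω = ⊤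

/-- Generation time of the latest generated packet among those received by time `t`; the monitor
is up to date at time `0`, so this is `0` as long as nothing has been received. -/
def latestReceived (X : ℕ → Ω → ℝ) (r : ℕ → Ω → WithTop ℝ) (t : ℝ) (ω : Ω) : ℝ :=
  sSup ({0} ∪ {x : ℝ | ∃ i : ℕ, r i ω ≤ (t : WithTop ℝ) ∧ x = genTime X i ω})

/-- Age of information of the monitor at time `t`. -/
def age (X : ℕ → Ω → ℝ) (r : ℕ → Ω → WithTop ℝ) (t : ℝ) (ω : Ω) : ℝ :=
  t - latestReceived X r t ω

/-- Average age of information over `[0, t]`. -/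
def avgAge (X : ℕ → Ω → ℝ) (r : ℕ → Ω → WithTop ℝ) (t : ℝ) (ω : Ω) : ℝ :=
  (1 / t) * ∫ s in (0 : ℝ)..t, age X r s ω

/-- Number of packets transmitted until time `t`. -/
def numTx (r : ℕ → Ω → WithTop ℝ) (t : ℝ) (ω : Ω) : ℕ :=
  {i : ℕ | r i ω ≤ (t : WithTop ℝ)}.ncard

/-- Average transmission cost over `[0, t]`, each transmission costing `c`. -/
def avgTxCost (c : ℝ) (r : ℕ → Ω → WithTop ℝ) (t : ℝ) (ω : Ω) : ℝ :=
  c / t * (numTx r t ω : ℝ)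

/-- The objective at time `t`. -/
def totalCost (ρ c : ℝ) (X : ℕ → Ω → ℝ) (r : ℕ → Ω → WithTop ℝ) (t : ℝ) (ω : Ω) : ℝ :=
  ρ * avgTxCost c r t ω + avgAge X r t ω

/-- Start of the `n`-th cycle of a non-buffering policy: time `0` for `n = 0`, and otherwise the
generation time of the `n`-th packet that gets transmitted. -/
def cycleStart (X : ℕ → Ω → ℝ) (r : ℕ → Ω → WithTop ℝ) : ℕ → Ω → ℝ
  | 0, _ => 0
  | n + 1, ω => genTime X (Nat.nth (fun i => r i ω ≠ ⊤) n) ω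

/-- Length of the `n`-th cycle. -/
def cycleLength (X : ℕ → Ω → ℝ) (r : ℕ → Ω → WithTop ℝ) (n : ℕ) (ω : Ω) : ℝ :=
  cycleStart X r (n + 1) ω - cycleStart X r n ω

/-- Causal non-buffering policies under which almost surely all cycles are finite and the cycle
lengths are independent and identically distributed with finite mean. Every policy that takes its
decisions in each cycle by one and the same rule (and has integrable cycle length) is of this
kind. -/
structure IsStationaryNB (𝓡 : MeasurableSpace Ω) [mΩ : MeasurableSpace Ω] (h𝓡 : 𝓡 ≤ mΩ)
    (μ : Measure Ω) (X : ℕ → Ω → ℝ) (hX : ∀ i, Measurable (X i))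
    (r : ℕ → Ω → WithTop ℝ) : Prop where
  causal : IsCausal 𝓡 h𝓡 X hX r
  nonBuffering : IsNonBuffering X r
  cycles_finite : ∀ᵐ ω ∂μ, {i : ℕ | r i ω ≠ ⊤}.Infinite
  indep : iIndepFun (cycleLength X r) μ
  identDistrib : ∀ n, IdentDistrib (cycleLength X r n) (cycleLength X r 0) μ μ
  integrable : Integrable (cycleLength X r 0) μ

/-- The cycle cost `(Var T + 2ρc) / (2 E T) + E T / 2`, where `T` is the cycle length. It is
extended-real valued so that it is `∞` when the cycle length has infinite variance. -/
def cycleCost [MeasurableSpace Ω] (μ : Measure Ω) (ρ c : ℝ) (X : ℕ → Ω → ℝ)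
    (r : ℕ → Ω → WithTop ℝ) : ℝ≥0∞ :=
  (evariance (cycleLength X r 0) μ + ENNReal.ofReal (2 * (ρ * c))) /
      ENNReal.ofReal (2 * ∫ ω, cycleLength X r 0 ω ∂μ)
    + ENNReal.ofReal ((∫ ω, cycleLength X r 0 ω ∂μ) / 2)

/-- For the threshold rule with threshold `θ`: start of the cycle that is in progress just before
packet `i` is generated. -/
def thresholdStart (X : ℕ → Ω → ℝ) (θ : ℝ) : ℕ → Ω → ℝ
  | 0, _ => 0
  | i + 1, ω =>
    if θ < genTime X i ω - thresholdStart X θ i ω then genTime X i ω else thresholdStart X θ i ω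

/-- The threshold policy: a packet is transmitted, immediately when it is generated, if at that
moment more than `θ` time units have passed since the start of the ongoing cycle; otherwise it is
never transmitted. -/
def thresholdPolicy (X : ℕ → Ω → ℝ) (θ : ℝ) (i : ℕ) (ω : Ω) : WithTop ℝ :=
  if θ < genTime X i ω - thresholdStart X θ i ω then (genTime X i ω : WithTop ℝ) else ⊤

/-- The threshold `√(1/q² + 2ρc) - 1/q`. -/
def optThreshold (q ρ c : ℝ) : ℝ :=
  Real.sqrt (1 / q ^ 2 + 2 * (ρ * c)) - 1 / q

end

end AoI

namespace AoI

/-! ### The exponential distribution -/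

section Exponential

variable {q : ℝ}

/-! The lower bound is a verification argument for an average-cost control problem. Put κ = ρc, θ =
T*, β = θ + 1/q, and let V(y) = β min(y, θ) − min(y, θ)²/2 (`ageValue`); the choice of θ means κ =
V(θ) (`mul_eq_optThreshold`). Cut time at the generations. Suppose that the age just before packet j
is at least x, that the next packet comes l later, and that the first transmission comes after a
delay s. No received packet is newer than packet j, so, whatever is sent, the age integrates over
the slot to at least l²/2 + x min(s, l). Adding κ if s < l, subtracting βl and adding the increment
of V gives `slotCost`.

The key fact is that the mean of `slotCost` over an exponential l is nonnegative for all x in [0, θ]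
and all s (`integral_slotCost_nonneg`). It vanishes for s = ∞, and a transmission at s adds at least
exp(−qs)(κ − V(x)) ≥ 0; memorylessness and concavity of V give this.

Causality says that s depends only on the private randomness and on the generations up to packet j
(`exists_first_transmission`), hence is independent of l. The centred slot costs are then orthogonal
with bounded second moments, so their sums are negligible along the squares. Since V is bounded and
the accumulated cost is monotone in time, `ae_le_liminf_totalCost` follows for every causal policy,
buffering or not.

Conversely, renewal-reward bounds the long-run cost of a stationary policy with square integrable
cycles by (κ + E T²/2)/E T, which is the cycle cost (`ae_eventually_totalCost_lt`,
`cycleCost_eq_ofReal`). For the threshold policy memorylessness gives i.i.d. cycles distributed as θ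
plus an exponential variable, and the bound equals β. Optimality of the cycle cost needs no
optimisation: for any stationary policy it dominates a long-run cost, which is at least β. -/

theorem expMeasure_Ioi (hq : 0 < q) (a : ℝ) :
    expMeasure q (Set.Ioi a) = ENNReal.ofReal (Real.exp (-(q * max a 0))) := by
  have := isProbabilityMeasure_expMeasure hq
  have h1 : (expMeasure q).real (Set.Iic a) = if 0 ≤ a then 1 - Real.exp (-(q * a)) else 0 := by
    rw [← cdf_eq_real, cdf_expMeasure_eq hq]
  have h2 : (expMeasure q).real (Set.Ioi a) = 1 - (expMeasure q).real (Set.Iic a) := by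
    rw [← Set.compl_Iic, probReal_compl_eq_one_sub measurableSet_Iic]
  rw [← ofReal_measureReal, h2, h1]
  split_ifs with h
  · rw [max_eq_left h]; congr 1; ring
  · rw [max_eq_right (le_of_not_ge h)]; simp

theorem ae_pos_expMeasure (hq : 0 < q) : ∀ᵐ x ∂expMeasure q, 0 < x := by
  have := isProbabilityMeasure_expMeasure hq
  have h : expMeasure q (Set.Ioi 0) = 1 := by simp [expMeasure_Ioi hq]
  exact (prob_compl_eq_zero_iff measurableSet_Ioi).2 h

/-- Memorylessness of the exponential distribution. -/
theorem expMeasure_restrict_Ioi_map_sub (hq : 0 < q) {a : ℝ} (ha : 0 ≤ a) :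
    ((expMeasure q).restrict (Set.Ioi a)).map (fun x => x - a) =
      ENNReal.ofReal (Real.exp (-(q * a))) • expMeasure q := by
  have := isProbabilityMeasure_expMeasure hq
  have hm : Measurable fun x : ℝ => x - a := by fun_prop
  have hIoi : ∀ b : ℝ, ((expMeasure q).restrict (Set.Ioi a)).map (fun x => x - a) (Set.Ioi b) =
      (ENNReal.ofReal (Real.exp (-(q * a))) • expMeasure q) (Set.Ioi b) := by
    intro b
    have hset : (fun x : ℝ => x - a) ⁻¹' Set.Ioi b ∩ Set.Ioi a = Set.Ioi (a + max b 0) := by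
      ext x
      simp only [Set.mem_inter_iff, Set.mem_preimage, Set.mem_Ioi]
      rcases le_total b 0 with hb | hb
      · rw [max_eq_right hb]; constructor
        · rintro ⟨_, h⟩; linarith
        · intro h; constructor <;> linarith
      · rw [max_eq_left hb]; constructor
        · rintro ⟨h, _⟩; linarith
        · intro h; constructor <;> linarith
    rw [Measure.map_apply hm measurableSet_Ioi,
      Measure.restrict_apply (hm measurableSet_Ioi), hset, Measure.smul_apply,
      expMeasure_Ioi hq, expMeasure_Ioi hq, smul_eq_mul,
      ← ENNReal.ofReal_mul (Real.exp_nonneg _), ← Real.exp_add,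
      max_eq_left (add_nonneg ha (le_max_right b 0))]
    congr 2; ring
  have huniv : ((expMeasure q).restrict (Set.Ioi a)).map (fun x => x - a) Set.univ =
      (ENNReal.ofReal (Real.exp (-(q * a))) • expMeasure q) Set.univ := by
    rw [Measure.map_apply hm MeasurableSet.univ, Set.preimage_univ, Measure.restrict_apply_univ,
      Measure.smul_apply, expMeasure_Ioi hq, max_eq_left ha]
    simp
  have hfin : IsFiniteMeasure (ENNReal.ofReal (Real.exp (-(q * a))) • expMeasure q) :=
    Measure.smul_finite _ ENNReal.ofReal_ne_top
  refine Measure.ext_of_Iic _ _ fun b => ?_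
  rw [← Set.compl_Ioi, measure_compl measurableSet_Ioi (measure_ne_top _ _),
    measure_compl measurableSet_Ioi (measure_ne_top _ _), hIoi, huniv]

theorem setIntegral_Ioi_comp_sub_expMeasure (hq : 0 < q) {a : ℝ} (ha : 0 ≤ a) (f : ℝ → ℝ) :
    ∫ x in Set.Ioi a, f (x - a) ∂expMeasure q =
      Real.exp (-(q * a)) * ∫ x, f x ∂expMeasure q := by
  have h : ∫ x, f x ∂((expMeasure q).restrict (Set.Ioi a)).map (fun x => x - a) =
      ∫ x in Set.Ioi a, f (x - a) ∂expMeasure q :=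
    (MeasurableEquiv.subRight a).measurableEmbedding.integral_map _
  rw [← h, expMeasure_restrict_Ioi_map_sub hq ha, integral_smul_measure,
    ENNReal.toReal_ofReal (Real.exp_nonneg _), smul_eq_mul]

theorem expMeasure_eq_withDensity (q : ℝ) :
    expMeasure q = (volume : Measure ℝ).withDensity (exponentialPDF q) := rfl

theorem integral_expMeasure (hq : 0 < q) (f : ℝ → ℝ) :
    ∫ x, f x ∂expMeasure q = ∫ x in Set.Ioi 0, q * Real.exp (-(q * x)) * f x := by
  have hm : Measurable (exponentialPDF q) :=
    (measurable_exponentialPDFReal q).ennreal_ofReal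
  rw [expMeasure_eq_withDensity, integral_withDensity_eq_integral_toReal_smul₀ hm.aemeasurable
    (by simp [exponentialPDF]), ← integral_Ici_eq_integral_Ioi,
    ← integral_indicator measurableSet_Ici]
  congr 1
  ext x
  rw [Set.indicator_apply]
  split_ifs with h
  · rw [exponentialPDF_of_nonneg h, ENNReal.toReal_ofReal (by positivity), smul_eq_mul]
  · rw [exponentialPDF_of_neg (not_le.1 h)]; simp

theorem integral_pow_expMeasure (hq : 0 < q) (n : ℕ) :
    ∫ x, x ^ n ∂expMeasure q = n.factorial / q ^ n := by
  have h := Real.integral_rpow_mul_exp_neg_mul_Ioi (a := n + 1) (by positivity) hq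
  rw [integral_expMeasure hq]
  have : ∀ x : ℝ, q * Real.exp (-(q * x)) * x ^ n =
      q * (x ^ ((n : ℝ) + 1 - 1) * Real.exp (-(q * x))) := by
    intro x; rw [add_sub_cancel_right, Real.rpow_natCast]; ring
  simp_rw [this]
  rw [integral_const_mul, h, Real.Gamma_nat_eq_factorial,
    show ((n : ℝ) + 1) = ((n + 1 : ℕ) : ℝ) by push_cast; ring, Real.rpow_natCast, one_div, inv_pow, pow_succ]
  field_simp

/-- The integral of a nonintegrable function is 0 by convention, whereas the computed moment is
positive. -/
theorem integrable_pow_expMeasure (hq : 0 < q) (n : ℕ) :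
    Integrable (fun x => x ^ n) (expMeasure q) := by
  by_contra h
  have h1 := integral_undef h
  rw [integral_pow_expMeasure hq] at h1
  have : (0 : ℝ) < n.factorial / q ^ n := by positivity
  exact this.ne' h1

theorem integrable_id_expMeasure (hq : 0 < q) : Integrable (fun x => x) (expMeasure q) := by
  simpa using integrable_pow_expMeasure hq 1

theorem integral_id_expMeasure (hq : 0 < q) : ∫ x, x ∂expMeasure q = 1 / q := by
  simpa using integral_pow_expMeasure hq 1

theorem integral_sq_expMeasure (hq : 0 < q) : ∫ x, x ^ 2 ∂expMeasure q = 2 / q ^ 2 := by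
  simpa using integral_pow_expMeasure hq 2

end Exponential

/-! ### The potential and the expected cost of a slot -/

section Slot

/-- Relative value of the age `y` at the moment when a packet is generated, for the threshold
policy with threshold `θ` and average cost `β`. -/
noncomputable def ageValue (β θ y : ℝ) : ℝ := β * min y θ - (min y θ) ^ 2 / 2

/-- Lower bound for the relative cost of the time between two generations that are `l` apart, when
the age was (at least) `x` just before the first one and the first transmission after it occurs `s`
time units later. -/
noncomputable def slotCost (β θ κ x : ℝ) (s : ℝ≥0∞) (l : ℝ) : ℝ :=
  l ^ 2 / 2 + x * (min s (ENNReal.ofReal l)).toReal - β * l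
    + (if s < ENNReal.ofReal l then κ else 0)
    + ageValue β θ (if s < ENNReal.ofReal l then l else l + x) - ageValue β θ x

variable {β θ κ q : ℝ}

theorem measurable_ageValue : Measurable (ageValue β θ) := by
  unfold ageValue; fun_prop

theorem ageValue_zero (hθ : 0 ≤ θ) : ageValue β θ 0 = 0 := by
  simp [ageValue, min_eq_left hθ]

theorem ageValue_of_le {y : ℝ} (h : y ≤ θ) : ageValue β θ y = β * y - y ^ 2 / 2 := by
  simp [ageValue, min_eq_left h]

theorem ageValue_of_ge {y : ℝ} (h : θ ≤ y) : ageValue β θ y = β * θ - θ ^ 2 / 2 := by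
  simp [ageValue, min_eq_right h]

/-- Because of this the age can be truncated at θ after each slot without changing the potential. -/
theorem ageValue_min (y : ℝ) : ageValue β θ (min θ y) = ageValue β θ y := by
  unfold ageValue; rw [min_comm θ y, min_assoc, min_self]

/-- The parabola βy − y²/2 increases up to its vertex β, and it is frozen from θ ≤ β on. -/
theorem ageValue_mono (hβ : θ ≤ β) : Monotone (ageValue β θ) := by
  intro y z hyz
  have h1 : min y θ ≤ min z θ := min_le_min_right _ hyz
  have h2 : min z θ ≤ θ := min_le_right _ _
  unfold ageValue
  nlinarith

theorem ageValue_nonneg (hθ : 0 ≤ θ) (hβ : θ ≤ β) {y : ℝ} (hy : 0 ≤ y) : 0 ≤ ageValue β θ y :=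
  (ageValue_zero (β := β) hθ).symm.le.trans (ageValue_mono hβ hy)

theorem ageValue_le (hβ : θ ≤ β) (y : ℝ) : ageValue β θ y ≤ β * θ - θ ^ 2 / 2 := by
  rcases le_total y θ with h | h
  · rw [← ageValue_of_ge (β := β) le_rfl]; exact ageValue_mono hβ h
  · exact (ageValue_of_ge h).le

/-- The potential is concave, so its increments decrease. -/
theorem ageValue_add_sub_le (hβ : θ ≤ β) {x s l : ℝ} (hx : 0 ≤ x) (hs : 0 ≤ s) :
    ageValue β θ (s + l + x) - ageValue β θ (s + l) ≤ ageValue β θ (l + x) - ageValue β θ l := by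
  rcases le_total (s + l + x) θ with h1 | h1
  · rw [ageValue_of_le h1, ageValue_of_le (by linarith : s + l ≤ θ),
      ageValue_of_le (by linarith : l + x ≤ θ), ageValue_of_le (by linarith : l ≤ θ)]
    nlinarith
  · rw [ageValue_of_ge h1]
    rcases le_total (l + x) θ with h2 | h2
    · rw [ageValue_of_le h2, ageValue_of_le (by linarith : l ≤ θ)]
      rcases le_total (s + l) θ with h3 | h3
      · rw [ageValue_of_le h3]
        nlinarith
      · rw [ageValue_of_ge h3]
        nlinarith
    · rw [ageValue_of_ge h2]
      have := ageValue_mono hβ (show l ≤ s + l by linarith)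
      linarith

theorem measurable_slotCost :
    Measurable fun p : ℝ × ℝ≥0∞ × ℝ => slotCost β θ κ p.1 p.2.1 p.2.2 := by
  have hset : MeasurableSet {p : ℝ × ℝ≥0∞ × ℝ | p.2.1 < ENNReal.ofReal p.2.2} :=
    measurableSet_lt (by fun_prop) (by fun_prop)
  unfold slotCost
  refine Measurable.sub (Measurable.add (Measurable.add (by fun_prop)
    (Measurable.ite hset (by fun_prop) (by fun_prop)))
    (measurable_ageValue.comp (Measurable.ite hset (by fun_prop) (by fun_prop))))
    (measurable_ageValue.comp (by fun_prop))

theorem measurable_slotCost_right (x : ℝ) (s : ℝ≥0∞) : Measurable (slotCost β θ κ x s) := by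
  have hset : MeasurableSet {l : ℝ | s < ENNReal.ofReal l} :=
    measurableSet_lt (by fun_prop) (by fun_prop)
  unfold slotCost
  refine Measurable.sub (Measurable.add (Measurable.add (by fun_prop)
    (Measurable.ite hset (by fun_prop) (by fun_prop)))
    (measurable_ageValue.comp (Measurable.ite hset (by fun_prop) (by fun_prop)))) (by fun_prop)

theorem min_ofReal_toReal_mem {s : ℝ≥0∞} {l : ℝ} (hl : 0 ≤ l) :
    0 ≤ (min s (ENNReal.ofReal l)).toReal ∧ (min s (ENNReal.ofReal l)).toReal ≤ l := by
  refine ⟨ENNReal.toReal_nonneg, ?_⟩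
  calc (min s (ENNReal.ofReal l)).toReal ≤ (ENNReal.ofReal l).toReal :=
        ENNReal.toReal_mono ENNReal.ofReal_ne_top (min_le_right _ _)
    _ = l := ENNReal.toReal_ofReal hl

/-- Uniformity in x and s matters: it later bounds the second moments of all centred slot costs by
one constant. -/
theorem abs_slotCost_le (hθ : 0 ≤ θ) (hβ : θ ≤ β) (hκ : 0 ≤ κ) {x : ℝ} (hx : x ∈ Set.Icc 0 θ)
    (s : ℝ≥0∞) {l : ℝ} (hl : 0 ≤ l) :
    |slotCost β θ κ x s l| ≤ (1 + 2 * β + κ + β * θ) * (1 + l ^ 2) := by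
  obtain ⟨hm0, hm1⟩ := min_ofReal_toReal_mem (s := s) hl
  have hx0 := hx.1
  have hx1 := hx.2
  have hxm : x * (min s (ENNReal.ofReal l)).toReal ≤ β * l :=
    mul_le_mul (hx1.trans hβ) hm1 hm0 (hx0.trans (hx1.trans hβ))
  have hxm0 : 0 ≤ x * (min s (ENNReal.ofReal l)).toReal := mul_nonneg hx0 hm0
  have hι : 0 ≤ (if s < ENNReal.ofReal l then κ else 0) ∧
      (if s < ENNReal.ofReal l then κ else 0) ≤ κ := by split_ifs <;> simp [hκ]
  have hy : 0 ≤ (if s < ENNReal.ofReal l then l else l + x) := by split_ifs <;> linarith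
  have hw0 := ageValue_nonneg hθ hβ hy
  have hw1 := ageValue_le hβ (if s < ENNReal.ofReal l then l else l + x)
  have hv0 := ageValue_nonneg hθ hβ hx0
  have hv1 := ageValue_le hβ x
  have hl2 : l ≤ 1 + l ^ 2 := by nlinarith
  have hβl : β * l ≤ β * (1 + l ^ 2) := mul_le_mul_of_nonneg_left hl2 (hθ.trans hβ)
  have hβl0 : 0 ≤ β * l := mul_nonneg (hθ.trans hβ) hl
  have hκl : 0 ≤ κ * l ^ 2 := by positivity
  have hβθ : 0 ≤ β * θ * l ^ 2 := mul_nonneg (mul_nonneg (hθ.trans hβ) hθ) (sq_nonneg l)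
  unfold slotCost
  rw [abs_le]
  constructor <;> nlinarith [sq_nonneg θ, sq_nonneg l]

theorem integrable_slotCost (hq : 0 < q) (hθ : 0 ≤ θ) (hβ : θ ≤ β) (hκ : 0 ≤ κ) {x : ℝ}
    (hx : x ∈ Set.Icc 0 θ) (s : ℝ≥0∞) :
    Integrable (slotCost β θ κ x s) (expMeasure q) := by
  have := isProbabilityMeasure_expMeasure hq
  have hm := measurable_slotCost_right (β := β) (θ := θ) (κ := κ) x s
  have hbound : Integrable (fun l : ℝ => (1 + 2 * β + κ + β * θ) * (1 + l ^ 2)) (expMeasure q) :=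
    Integrable.const_mul (Integrable.add (integrable_const 1) (integrable_pow_expMeasure hq 2)) _
  refine Integrable.mono' hbound hm.aestronglyMeasurable ?_
  filter_upwards [ae_pos_expMeasure hq] with l hl
  rw [Real.norm_eq_abs]
  exact abs_slotCost_le hθ hβ hκ hx s hl.le

theorem slotCost_top (x l : ℝ) (hl : 0 ≤ l) : slotCost β θ κ x ⊤ l =
    l ^ 2 / 2 + x * l - β * l + ageValue β θ (l + x) - ageValue β θ x := by
  simp [slotCost, ENNReal.toReal_ofReal hl]

/-- If no packet is transmitted, the expected relative cost of a slot vanishes. -/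
theorem integral_slotCost_top (hq : 0 < q) (hβ : β = θ + 1 / q) {x : ℝ} (hx : x ∈ Set.Icc 0 θ) :
    ∫ l, slotCost β θ κ x ⊤ l ∂expMeasure q = 0 := by
  -- While the age stays below θ, the potential offsets the running cost exactly. If it passes θ,
  -- the excess m = l − (θ − x) leaves m²/2 − (β − θ)m, and β − θ = 1/q.
  have h1 : ∫ l, slotCost β θ κ x ⊤ l ∂expMeasure q =
      ∫ l in Set.Ioi (θ - x), ((l - (θ - x)) ^ 2 / 2 - (l - (θ - x)) / q) ∂expMeasure q := by
    rw [← integral_indicator measurableSet_Ioi]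
    refine integral_congr_ae ?_
    filter_upwards [ae_pos_expMeasure hq] with l hl
    rw [slotCost_top _ _ hl.le, ageValue_of_le hx.2, Set.indicator_apply]
    split_ifs with h
    · rw [ageValue_of_ge (by rw [Set.mem_Ioi] at h; linarith), hβ]
      field_simp; ring
    · rw [ageValue_of_le (by rw [Set.mem_Ioi] at h; linarith)]; ring
  -- By memorylessness the excess is again exponential, and m²/2 and m/q both have mean 1/q².
  rw [h1, setIntegral_Ioi_comp_sub_expMeasure hq (sub_nonneg.2 hx.2)
    (fun l => l ^ 2 / 2 - l / q), integral_sub ((integrable_pow_expMeasure hq 2).div_const 2)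
    ((integrable_id_expMeasure hq).div_const q), integral_div, integral_div,
    integral_sq_expMeasure hq, integral_id_expMeasure hq]
  field_simp; ring

/-- Whatever the node does, the expected relative cost of a slot is nonnegative. -/
theorem integral_slotCost_nonneg (hq : 0 < q) (hθ : 0 ≤ θ) (hβ : β = θ + 1 / q)
    (hκ : κ = β * θ - θ ^ 2 / 2) {x : ℝ} (hx : x ∈ Set.Icc 0 θ) (s : ℝ≥0∞) :
    0 ≤ ∫ l, slotCost β θ κ x s l ∂expMeasure q := by
  have hq' : 0 < 1 / q := by positivity
  have hθβ : θ ≤ β := by linarith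
  have hκ0 : 0 ≤ κ := by rw [hκ, ← ageValue_of_ge (β := β) le_rfl]; exact ageValue_nonneg hθ hθβ hθ
  have h0 : (0 : ℝ) ∈ Set.Icc 0 θ := ⟨le_rfl, hθ⟩
  induction s with
  | top => exact (integral_slotCost_top hq hβ hx).ge
  | coe s =>
    have hint := fun {y : ℝ} (hy : y ∈ Set.Icc 0 θ) (s : ℝ≥0∞) =>
      integrable_slotCost (q := q) hq hθ hθβ hκ0 hy s
    -- A transmission at delay s pays κ and restarts the remaining waiting time from age 0 instead
    -- of x. The two no-transmission slots in ξ have mean zero, so only κ − V(x) survives.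
    let ξ : ℝ → ℝ := fun l =>
      κ - ageValue β θ x + (slotCost β θ κ 0 ⊤ l - slotCost β θ κ x ⊤ l)
    have hξint : Integrable ξ (expMeasure q) := by
      have := isProbabilityMeasure_expMeasure hq
      exact (integrable_const _).add ((hint h0 ⊤).sub (hint hx ⊤))
    have hξ : ∫ l, ξ l ∂expMeasure q = κ - ageValue β θ x := by
      have := isProbabilityMeasure_expMeasure hq
      simp only [ξ]
      have h := integral_sub (hint h0 ⊤) (hint hx ⊤)
      rw [integral_slotCost_top hq hβ h0, integral_slotCost_top hq hβ hx] at h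
      refine (integral_add (integrable_const _) ((hint h0 ⊤).sub (hint hx ⊤))).trans ?_
      refine (congrArg₂ (· + ·) rfl h).trans ?_
      simp
    have hξ2 := setIntegral_Ioi_comp_sub_expMeasure hq s.coe_nonneg ξ
    have hξ2int : IntegrableOn (fun l => ξ (l - s)) (Set.Ioi (s : ℝ)) (expMeasure q) := by
      have h := MeasurableEmbedding.integrable_map_iff
        (MeasurableEquiv.subRight (s : ℝ)).measurableEmbedding
        (μ := (expMeasure q).restrict (Set.Ioi (s : ℝ))) (g := ξ)
      refine h.1 ?_
      have h' := expMeasure_restrict_Ioi_map_sub hq s.coe_nonneg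
      have h'' : Integrable ξ (Measure.map (fun x => x - (s : ℝ))
          ((expMeasure q).restrict (Set.Ioi (s : ℝ)))) := by
        refine Eq.subst (motive := fun ν => Integrable ξ ν) h'.symm ?_
        exact hξint.smul_measure ENNReal.ofReal_ne_top
      exact h''
    have hle : ∫ l, (slotCost β θ κ x ⊤ l + (Set.Ioi (s : ℝ)).indicator (fun l => ξ (l - s)) l)
        ∂expMeasure q ≤ ∫ l, slotCost β θ κ x s l ∂expMeasure q := by
      refine integral_mono_ae ((hint hx ⊤).add
        ((integrable_indicator_iff measurableSet_Ioi).2 hξ2int)) (hint hx s) ?_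
      filter_upwards [ae_pos_expMeasure hq] with l hl
      have hs : (s : ℝ≥0∞) = ENNReal.ofReal s := (ENNReal.ofReal_coe_nnreal).symm
      by_cases h : (s : ℝ) < l
      · have h' : (s : ℝ≥0∞) < ENNReal.ofReal l := by
          rw [hs]; exact (ENNReal.ofReal_lt_ofReal_iff hl).2 h
        rw [slotCost_top _ _ hl.le, Set.indicator_of_mem (show l ∈ Set.Ioi (s : ℝ) from h)]
        simp only [ξ, slotCost, if_pos h', min_eq_left h'.le, ENNReal.coe_toReal]
        have hls : (0 : ℝ) ≤ l - s := by linarith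
        have h1 := slotCost_top (β := β) (θ := θ) (κ := κ) 0 (l - s) hls
        have h2 := slotCost_top (β := β) (θ := θ) (κ := κ) x (l - s) hls
        simp only [slotCost] at h1 h2
        rw [h1, h2, ageValue_zero hθ, add_zero]
        -- After the transmission the age is l, not l − s. Concavity absorbs the difference: raising
        -- the age by x is worth less at l than at l − s.
        have := ageValue_add_sub_le (l := l - s) (s := (s : ℝ)) hθβ hx.1 s.coe_nonneg
        rw [add_sub_cancel] at this
        linarith
      · have h' : ¬ (s : ℝ≥0∞) < ENNReal.ofReal l := by
          rw [hs]; exact not_lt.2 (ENNReal.ofReal_le_ofReal (not_lt.1 h))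
        rw [slotCost_top _ _ hl.le, Set.indicator_of_notMem (show l ∉ Set.Ioi (s : ℝ) from h)]
        simp only [slotCost, if_neg h', min_eq_right (not_lt.1 h'), ENNReal.toReal_ofReal hl.le]
        linarith
    refine le_trans ?_ hle
    rw [integral_add (hint hx ⊤) ((integrable_indicator_iff measurableSet_Ioi).2 hξ2int),
      integral_indicator measurableSet_Ioi, integral_slotCost_top hq hβ hx, hξ2, hξ, zero_add]
    have := ageValue_le hθβ x
    exact mul_nonneg (Real.exp_nonneg _) (by linarith)

end Slot

/-! ### A law of large numbers for orthogonal sequences -/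

section LLN

variable {Ω : Type*} [mΩ : MeasurableSpace Ω] {μ : Measure Ω}

/-- Pythagoras: the cross terms vanish. -/
theorem integral_sq_sum_le_of_orthogonal {D : ℕ → Ω → ℝ} {C : ℝ} (hD : ∀ i, MemLp (D i) 2 μ)
    (horth : ∀ i j, i < j → ∫ ω, D i ω * D j ω ∂μ = 0) (hC : ∀ i, ∫ ω, D i ω ^ 2 ∂μ ≤ C) (N : ℕ) :
    ∫ ω, (∑ i ∈ Finset.range N, D i ω) ^ 2 ∂μ ≤ C * N := by
  induction N with
  | zero => simp
  | succ N ih =>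
    have hS : MemLp (fun ω => ∑ i ∈ Finset.range N, D i ω) 2 μ :=
      memLp_finsetSum _ fun i _ => hD i
    have hcross : ∫ ω, (∑ i ∈ Finset.range N, D i ω) * D N ω ∂μ = 0 := by
      simp_rw [Finset.sum_mul]
      refine (integral_finsetSum _ fun i _ => (hD i).integrable_mul (hD N)).trans ?_
      exact Finset.sum_eq_zero fun i hi => horth i N (Finset.mem_range.1 hi)
    have hexp : ∀ ω, (∑ i ∈ Finset.range (N + 1), D i ω) ^ 2 =
        (∑ i ∈ Finset.range N, D i ω) ^ 2 +
          (2 * ((∑ i ∈ Finset.range N, D i ω) * D N ω) + D N ω ^ 2) := by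
      intro ω; rw [Finset.sum_range_succ]; ring
    simp_rw [hexp]
    have h1 : Integrable (fun ω => 2 * ((∑ i ∈ Finset.range N, D i ω) * D N ω)) μ :=
      (hS.integrable_mul (hD N)).const_mul 2
    have h2 := integral_add h1 (hD N).integrable_sq
    have h3 := integral_add hS.integrable_sq (h1.add (hD N).integrable_sq)
    rw [integral_const_mul, hcross] at h2
    simp only [Pi.add_apply] at h3
    have := hC N
    push_cast
    linarith

/-- Along N = n² the normalised sums have second moment at most C/n². This is summable, so the
series of their squares is almost surely finite and its terms tend to 0. The subsequence suffices
because consecutive squares have ratio tending to 1. -/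
theorem ae_tendsto_sum_div_sq_of_orthogonal {D : ℕ → Ω → ℝ} {C : ℝ} (hD : ∀ i, MemLp (D i) 2 μ)
    (horth : ∀ i j, i < j → ∫ ω, D i ω * D j ω ∂μ = 0) (hC : ∀ i, ∫ ω, D i ω ^ 2 ∂μ ≤ C) :
    ∀ᵐ ω ∂μ, Tendsto (fun n : ℕ => (∑ i ∈ Finset.range (n ^ 2), D i ω) / (n : ℝ) ^ 2)
      atTop (𝓝 0) := by
  let f : ℕ → Ω → ℝ := fun n ω => ((∑ i ∈ Finset.range (n ^ 2), D i ω) / (n : ℝ) ^ 2) ^ 2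
  have hS : ∀ N, MemLp (fun ω => ∑ i ∈ Finset.range N, D i ω) 2 μ :=
    fun N => memLp_finsetSum _ fun i _ => hD i
  have hfint : ∀ n, Integrable (f n) μ := by
    intro n
    have := ((hS (n ^ 2)).integrable_sq).div_const (((n : ℝ) ^ 2) ^ 2)
    simpa [f, div_pow] using this
  have hfle : ∀ n, ∫ ω, f n ω ∂μ ≤ C * (1 / (n : ℝ) ^ 2) := by
    intro n
    simp only [f, div_pow]
    rw [integral_div]
    have h := integral_sq_sum_le_of_orthogonal hD horth hC (n ^ 2)
    rcases Nat.eq_zero_or_pos n with rfl | hn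
    · simp
    · have hn' : (0 : ℝ) < (n : ℝ) ^ 2 := by positivity
      rw [div_le_iff₀ (by positivity)]
      refine h.trans (le_of_eq ?_)
      push_cast
      field_simp
  have hsum : Summable fun n : ℕ => C * (1 / (n : ℝ) ^ 2) :=
    (Real.summable_one_div_nat_pow.2 one_lt_two).mul_left C
  have hlint : ∑' n, ∫⁻ ω, ENNReal.ofReal (f n ω) ∂μ ≠ ⊤ := by
    have hle : ∀ n, ∫⁻ ω, ENNReal.ofReal (f n ω) ∂μ ≤ ENNReal.ofReal (C * (1 / (n : ℝ) ^ 2)) := by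
      intro n
      rw [← ofReal_integral_eq_lintegral_ofReal (hfint n) (ae_of_all _ fun ω => sq_nonneg _)]
      exact ENNReal.ofReal_le_ofReal (hfle n)
    exact ne_top_of_le_ne_top hsum.tsum_ofReal_ne_top (ENNReal.tsum_le_tsum hle)
  rw [← lintegral_tsum fun n => (hfint n).aemeasurable.ennreal_ofReal] at hlint
  have hae := ae_lt_top' (AEMeasurable.tsum
    fun n => (hfint n).aemeasurable.ennreal_ofReal) hlint
  filter_upwards [hae] with ω hω
  have h0 := ENNReal.tendsto_cofinite_zero_of_tsum_ne_top hω.ne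
  rw [Nat.cofinite_eq_atTop] at h0
  have h1 : Tendsto (fun n => f n ω) atTop (𝓝 0) := by
    have := (ENNReal.tendsto_toReal ENNReal.zero_ne_top).comp h0
    simpa [Function.comp_def, f, ENNReal.toReal_ofReal (sq_nonneg _)] using this
  have h2 := (Real.continuous_sqrt.tendsto 0).comp h1
  simp only [Real.sqrt_zero, Function.comp_def, f, Real.sqrt_sq_eq_abs] at h2
  exact (tendsto_zero_iff_abs_tendsto_zero _).2 h2

end LLN

/-- A centred function of an independent variable is orthogonal to the past. -/
theorem integral_mul_eq_zero_of_indep {Ω E : Type*} {m : MeasurableSpace Ω}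
    [mΩ : MeasurableSpace Ω] {μ : Measure Ω} [IsProbabilityMeasure μ] [MeasurableSpace E]
    (hm : m ≤ mΩ) {U : Ω → E} (hU : Measurable[m] U) {d : Ω → ℝ}
    (hd : Measurable[m] d) {L : Ω → ℝ} (hL : Measurable L)
    (hind : Indep m (MeasurableSpace.comap L inferInstance) μ) {h : E × ℝ → ℝ}
    (hh : Measurable h) (hzero : ∀ u, ∫ l, h (u, l) ∂(μ.map L) = 0) :
    ∫ ω, d ω * h (U ω, L ω) ∂μ = 0 := by
  have hW : Measurable[m] fun ω => (d ω, U ω) := hd.prodMk hU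
  have hW' : Measurable fun ω => (d ω, U ω) := hW.mono hm le_rfl
  have hindf : IndepFun (fun ω => (d ω, U ω)) L μ :=
    indep_of_indep_of_le_left hind hW.comap_le
  have hprod := (indepFun_iff_map_prod_eq_prod_map_map hW'.aemeasurable hL.aemeasurable).1 hindf
  have := Measure.isProbabilityMeasure_map (μ := μ) hL.aemeasurable
  have := Measure.isProbabilityMeasure_map (μ := μ) hW'.aemeasurable
  let g : (ℝ × E) × ℝ → ℝ := fun p => p.1.1 * h (p.1.2, p.2)
  have hg : Measurable g := by
    refine Measurable.mul (by fun_prop) (hh.comp (by fun_prop))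
  have hmap : ∫ p, g p ∂(μ.map fun ω => ((d ω, U ω), L ω)) = ∫ ω, d ω * h (U ω, L ω) ∂μ :=
    integral_map (hW'.prodMk hL).aemeasurable hg.aestronglyMeasurable
  rw [← hmap, hprod]
  by_cases hint : Integrable g ((μ.map fun ω => (d ω, U ω)).prod (μ.map L))
  · rw [integral_prod _ hint]
    have : ∀ w : ℝ × E, ∫ l, g (w, l) ∂(μ.map L) = 0 := by
      intro w
      simp only [g]
      rw [integral_const_mul, hzero, mul_zero]
    simp [this]
  -- Here the conclusion is the default value 0 of the integral.
  · exact integral_undef hint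

/-! ### The accumulated slot costs are asymptotically nonnegative -/

section SlotLLN

variable {β θ κ q : ℝ}

theorem measurable_integral_slotCost (hq : 0 < q) : Measurable fun p : ℝ × ℝ≥0∞ =>
    ∫ l, slotCost β θ κ p.1 p.2 l ∂expMeasure q := by
  have := isProbabilityMeasure_expMeasure hq
  have hm : Measurable fun p : (ℝ × ℝ≥0∞) × ℝ => slotCost β θ κ p.1.1 p.1.2 p.2 := by
    have he : Measurable fun p : (ℝ × ℝ≥0∞) × ℝ => (p.1.1, p.1.2, p.2) := by fun_prop
    have := Measurable.comp (measurable_slotCost (β := β) (θ := θ) (κ := κ)) he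
    simpa only [Function.comp_def] using this
  exact (hm.stronglyMeasurable.integral_prod_right' (ν := expMeasure q)).measurable

theorem integral_sub_integral_eq_zero {ν : Measure ℝ} [IsProbabilityMeasure ν] (f : ℝ → ℝ) :
    ∫ l, (f l - ∫ l', f l' ∂ν) ∂ν = 0 := by
  by_cases hf : Integrable f ν
  · rw [integral_sub hf (integrable_const _)]; simp
  · rw [integral_undef hf]; simp [integral_undef hf]

variable {Ω : Type*} [mΩ : MeasurableSpace Ω] {μ : Measure Ω} [IsProbabilityMeasure μ]

/-- Each slot cost is its conditional mean given `G j`, which is nonnegative, plus a martingale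
difference; the differences obey the law of large numbers above. -/
theorem ae_sum_slotCost_ge (hq : 0 < q) (hθ : 0 ≤ θ) (hβ : β = θ + 1 / q)
    (hκ : κ = β * θ - θ ^ 2 / 2) (G : Filtration ℕ mΩ) {x : ℕ → Ω → ℝ} {s : ℕ → Ω → ℝ≥0∞}
    {L : ℕ → Ω → ℝ} (hx : ∀ j, Measurable[G j] (x j)) (hs : ∀ j, Measurable[G j] (s j))
    (hL : ∀ j, Measurable[G (j + 1)] (L j)) (hL0 : ∀ j ω, 0 ≤ L j ω)
    (hx01 : ∀ j ω, x j ω ∈ Set.Icc 0 θ)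
    (hind : ∀ j, Indep (G j) (MeasurableSpace.comap (L j) inferInstance) μ)
    (hlaw : ∀ j, μ.map (L j) = expMeasure q) :
    ∀ᵐ ω ∂μ, ∃ e : ℕ → ℝ, Tendsto e atTop (𝓝 0) ∧
      ∀ n : ℕ, e n * (n : ℝ) ^ 2 ≤
        ∑ i ∈ Finset.range (n ^ 2), slotCost β θ κ (x i ω) (s i ω) (L i ω) := by
  have hpe := isProbabilityMeasure_expMeasure hq
  have hq' : 0 < 1 / q := by positivity
  have hθβ : θ ≤ β := by linarith
  have hκ0 : 0 ≤ κ := by rw [hκ, ← ageValue_of_ge (β := β) le_rfl]; exact ageValue_nonneg hθ hθβ hθ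
  let φ : ℝ × ℝ≥0∞ → ℝ := fun p => ∫ l, slotCost β θ κ p.1 p.2 l ∂expMeasure q
  have hφ : Measurable φ := measurable_integral_slotCost hq
  let h : (ℝ × ℝ≥0∞) × ℝ → ℝ := fun p => slotCost β θ κ p.1.1 p.1.2 p.2 - φ p.1
  have hh : Measurable h := by
    have he : Measurable fun p : (ℝ × ℝ≥0∞) × ℝ => (p.1.1, p.1.2, p.2) := by fun_prop
    have h1 := Measurable.comp (measurable_slotCost (β := β) (θ := θ) (κ := κ)) he
    exact Measurable.sub h1 (hφ.comp measurable_fst)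
  have hLm : ∀ j, Measurable (L j) := fun j => (hL j).mono (G.le _) le_rfl
  -- `D j` is the slot cost minus its mean over an independent `L j`. For i < j, `D i` is known at
  -- stage j, whence orthogonality.
  let D : ℕ → Ω → ℝ := fun j ω => h ((x j ω, s j ω), L j ω)
  have hDm : ∀ j, Measurable[G (j + 1)] (D j) := by
    intro j
    have h1 : Measurable[G (j + 1)] fun ω => ((x j ω, s j ω), L j ω) :=
      (((hx j).mono (G.mono j.le_succ) le_rfl).prodMk
        ((hs j).mono (G.mono j.le_succ) le_rfl)).prodMk (hL j)
    exact hh.comp h1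
  set K : ℝ := 1 + 2 * β + κ + β * θ with hK
  have hK0 : 0 ≤ K := by
    have : 0 ≤ β * θ := mul_nonneg (hθ.trans hθβ) hθ
    linarith
  have hbint : Integrable (fun l : ℝ => K * (1 + l ^ 2)) (expMeasure q) :=
    Integrable.const_mul (Integrable.add (integrable_const 1) (integrable_pow_expMeasure hq 2)) _
  set M : ℝ := ∫ l, K * (1 + l ^ 2) ∂expMeasure q with hM
  have hφle : ∀ p : ℝ × ℝ≥0∞, p.1 ∈ Set.Icc 0 θ → |φ p| ≤ M := by
    intro p hp
    rw [← Real.norm_eq_abs]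
    refine norm_integral_le_of_norm_le hbint ?_
    filter_upwards [ae_pos_expMeasure hq] with l hl
    rw [Real.norm_eq_abs]
    exact abs_slotCost_le hθ hθβ hκ0 hp _ hl.le
  have hDle : ∀ j ω, D j ω ^ 2 ≤ (K * (1 + L j ω ^ 2) + M) ^ 2 := by
    intro j ω
    have h1 := abs_slotCost_le hθ hθβ hκ0 (hx01 j ω) (s j ω) (hL0 j ω)
    have h2 := hφle (x j ω, s j ω) (hx01 j ω)
    refine sq_le_sq' ?_ ?_
    · have := abs_le.1 h1; have := abs_le.1 h2
      simp only [D, h]; linarith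
    · have := abs_le.1 h1; have := abs_le.1 h2
      simp only [D, h]; linarith
  have hb2 : Integrable (fun l : ℝ => (K * (1 + l ^ 2) + M) ^ 2) (expMeasure q) := by
    have : (fun l : ℝ => (K * (1 + l ^ 2) + M) ^ 2) = fun l =>
        K ^ 2 * l ^ 4 + (2 * K * (K + M) * l ^ 2 + (K + M) ^ 2) := by
      ext l; ring
    rw [this]
    exact Integrable.add ((integrable_pow_expMeasure hq 4).const_mul _)
      (Integrable.add ((integrable_pow_expMeasure hq 2).const_mul _) (integrable_const _))
  have hb2Ω : ∀ j, Integrable (fun ω => (K * (1 + L j ω ^ 2) + M) ^ 2) μ := by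
    intro j
    have h1 : Integrable (fun l : ℝ => (K * (1 + l ^ 2) + M) ^ 2) (μ.map (L j)) := by
      rw [hlaw]; exact hb2
    exact h1.comp_measurable (hLm j)
  have hDm' : ∀ j, Measurable (D j) := fun j => (hDm j).mono (G.le _) le_rfl
  have hDsq : ∀ j, Integrable (fun ω => D j ω ^ 2) μ := by
    intro j
    refine (hb2Ω j).mono' ((hDm' j).pow_const 2).aestronglyMeasurable (ae_of_all _ fun ω => ?_)
    rw [Real.norm_eq_abs, abs_of_nonneg (sq_nonneg _)]
    exact hDle j ω
  have hDL : ∀ j, MemLp (D j) 2 μ := fun j =>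
    (memLp_two_iff_integrable_sq (hDm' j).aestronglyMeasurable).2 (hDsq j)
  have hC : ∀ j, ∫ ω, D j ω ^ 2 ∂μ ≤ ∫ l, (K * (1 + l ^ 2) + M) ^ 2 ∂expMeasure q := by
    intro j
    have h1 : ∫ l, (K * (1 + l ^ 2) + M) ^ 2 ∂(μ.map (L j)) =
        ∫ ω, (K * (1 + L j ω ^ 2) + M) ^ 2 ∂μ :=
      integral_map (hLm j).aemeasurable (by fun_prop)
    rw [← hlaw j, h1]
    exact integral_mono (hDsq j) (hb2Ω j) (hDle j)
  have horth : ∀ i j, i < j → ∫ ω, D i ω * D j ω ∂μ = 0 := by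
    intro i j hij
    refine integral_mul_eq_zero_of_indep (G.le j) ((hx j).prodMk (hs j))
      ((hDm i).mono (G.mono hij) le_rfl) (hLm j) (hind j) hh fun u => ?_
    rw [hlaw j]
    exact integral_sub_integral_eq_zero _
  filter_upwards [ae_tendsto_sum_div_sq_of_orthogonal hDL horth hC] with ω hω
  refine ⟨_, hω, fun n => ?_⟩
  rcases Nat.eq_zero_or_pos n with rfl | hn
  · simp
  · rw [div_mul_cancel₀ _ (by positivity)]
    refine Finset.sum_le_sum fun i _ => ?_
    have := integral_slotCost_nonneg hq hθ hβ hκ (hx01 i ω) (s i ω)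
    simp only [D, h, φ]
    linarith

end SlotLLN

/-! ### What a causal policy knows between two generations -/

section GenTime

variable {Ω : Type*}

theorem genTime_succ (X : ℕ → Ω → ℝ) (i : ℕ) (ω : Ω) :
    genTime X (i + 1) ω = genTime X i ω + X (i + 1) ω := by
  unfold genTime; rw [Finset.sum_range_succ]

theorem genTime_mono (hX0 : ∀ i ω, 0 ≤ X i ω) (ω : Ω) : Monotone fun i => genTime X i ω :=
  monotone_nat_of_le_succ fun i => by
    rw [genTime_succ]; linarith [hX0 (i + 1) ω]

theorem genTime_nonneg (hX0 : ∀ i ω, 0 ≤ X i ω) (i : ℕ) (ω : Ω) : 0 ≤ genTime X i ω :=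
  Finset.sum_nonneg fun j _ => hX0 j ω

end GenTime

section Causal

/-- The sets that agree on `S` with a measurable set. -/
@[reducible] def traceSpace {Ω : Type*} (G : MeasurableSpace Ω) (S : Set Ω) : MeasurableSpace Ω where
  MeasurableSet' A := ∃ B, MeasurableSet[G] B ∧ ∀ ω ∈ S, (ω ∈ A ↔ ω ∈ B)
  measurableSet_empty := ⟨∅, MeasurableSet.empty, fun _ _ => Iff.rfl⟩
  measurableSet_compl := by
    rintro A ⟨B, hB, h⟩
    exact ⟨Bᶜ, hB.compl, fun ω hω => not_congr (h ω hω)⟩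
  measurableSet_iUnion := by
    intro f hf
    choose g hg h using hf
    refine ⟨⋃ i, g i, MeasurableSet.iUnion hg, fun ω hω => ?_⟩
    simp only [Set.mem_iUnion]
    exact exists_congr fun i => h i ω hω

/-- The hypotheses factor the probability of A ∩ B ∩ C completely, and the sets A ∩ B form a
π-system generating `m₁ ⊔ m₂`. -/
theorem indep_sup_left {Ω : Type*} {m₁ m₂ m₃ : MeasurableSpace Ω} [mΩ : MeasurableSpace Ω]
    {μ : Measure Ω} [IsProbabilityMeasure μ] (h₁ : m₁ ≤ mΩ) (h₂ : m₂ ≤ mΩ) (h₃ : m₃ ≤ mΩ)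
    (h₁₂₃ : Indep m₁ (m₂ ⊔ m₃) μ) (h₂₃ : Indep m₂ m₃ μ) : Indep (m₁ ⊔ m₂) m₃ μ := by
  let π : Set (Set Ω) := {C | ∃ A B, MeasurableSet[m₁] A ∧ MeasurableSet[m₂] B ∧ C = A ∩ B}
  have hπ : IsPiSystem π := by
    rintro _ ⟨A, B, hA, hB, rfl⟩ _ ⟨A', B', hA', hB', rfl⟩ -
    exact ⟨A ∩ A', B ∩ B', hA.inter hA', hB.inter hB', Set.inter_inter_inter_comm _ _ _ _⟩
  have hgen : m₁ ⊔ m₂ = MeasurableSpace.generateFrom π := by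
    apply le_antisymm
    · refine sup_le (fun A hA => ?_) (fun B hB => ?_)
      · exact MeasurableSpace.measurableSet_generateFrom
          ⟨A, Set.univ, hA, MeasurableSet.univ, (Set.inter_univ A).symm⟩
      · exact MeasurableSpace.measurableSet_generateFrom
          ⟨Set.univ, B, MeasurableSet.univ, hB, (Set.univ_inter B).symm⟩
    · refine MeasurableSpace.generateFrom_le ?_
      rintro _ ⟨A, B, hA, hB, rfl⟩
      exact MeasurableSet.inter ((le_sup_left : m₁ ≤ m₁ ⊔ m₂) A hA)
        ((le_sup_right : m₂ ≤ m₁ ⊔ m₂) B hB)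
  refine IndepSets.indep (sup_le h₁ h₂) h₃ hπ (@MeasurableSpace.isPiSystem_measurableSet Ω m₃)
    hgen (@MeasurableSpace.generateFrom_measurableSet Ω m₃).symm ?_
  rw [IndepSets_iff]
  rintro _ C ⟨A, B, hA, hB, rfl⟩ hC
  have hBC : MeasurableSet[m₂ ⊔ m₃] (B ∩ C) :=
    MeasurableSet.inter ((le_sup_left : m₂ ≤ m₂ ⊔ m₃) B hB)
      ((le_sup_right : m₃ ≤ m₂ ⊔ m₃) C hC)
  rw [Indep_iff] at h₁₂₃ h₂₃
  rw [Set.inter_assoc, h₁₂₃ A _ hA hBC, h₂₃ B C hB hC,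
    h₁₂₃ A B hA ((le_sup_left : m₂ ≤ m₂ ⊔ m₃) B hB), mul_assoc]

/-- The private randomness together with the generation times of packets `0, …, j`. -/
def slotFiltration {Ω : Type*} (𝓡 : MeasurableSpace Ω) [mΩ : MeasurableSpace Ω] (h𝓡 : 𝓡 ≤ mΩ)
    (X : ℕ → Ω → ℝ) (hX : ∀ i, Measurable (X i)) : Filtration ℕ mΩ where
  seq j := 𝓡 ⊔ ⨆ i ∈ Set.Iic j, MeasurableSpace.comap (X i) inferInstance
  mono' := fun _ _ hij =>
    sup_le_sup le_rfl (biSup_mono fun _ hi => Set.Iic_subset_Iic.2 hij hi)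
  le' := fun _ => sup_le h𝓡 (iSup₂_le fun i _ => (hX i).comap_le)

variable {Ω : Type*} {𝓡 : MeasurableSpace Ω} [mΩ : MeasurableSpace Ω] {h𝓡 : 𝓡 ≤ mΩ}
  {X : ℕ → Ω → ℝ} {hX : ∀ i, Measurable (X i)}

theorem measurable_slotFiltration {i j : ℕ} (hij : i ≤ j) :
    Measurable[slotFiltration 𝓡 h𝓡 X hX j] (X i) := by
  have h : MeasurableSpace.comap (X i) inferInstance ≤ slotFiltration 𝓡 h𝓡 X hX j :=
    le_trans (le_iSup₂_of_le (f := fun i (_ : i ∈ Set.Iic j) =>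
      MeasurableSpace.comap (X i) inferInstance) i hij le_rfl) le_sup_right
  exact Measurable.mono (comap_measurable (X i)) h le_rfl

theorem measurable_genTime_slotFiltration {i j : ℕ} (hij : i ≤ j) :
    Measurable[slotFiltration 𝓡 h𝓡 X hX j] (genTime X i) :=
  Finset.measurable_fun_sum _ fun _ hk =>
    measurable_slotFiltration ((Nat.lt_succ_iff.1 (Finset.mem_range.1 hk)).trans hij)

theorem indep_slotFiltration {μ : Measure Ω} [IsProbabilityMeasure μ] (hX_indep : iIndepFun X μ)
    (h𝓡_indep : Indep 𝓡 (⨆ i, MeasurableSpace.comap (X i) inferInstance) μ) (j : ℕ) :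
    Indep (slotFiltration 𝓡 h𝓡 X hX j) (MeasurableSpace.comap (X (j + 1)) inferInstance) μ := by
  have hle : ∀ i, MeasurableSpace.comap (X i) inferInstance ≤ mΩ := fun i => (hX i).comap_le
  refine indep_sup_left h𝓡 (iSup₂_le fun i _ => hle i) (hle _) ?_ ?_
  · refine indep_of_indep_of_le_right h𝓡_indep (sup_le (iSup₂_le fun i _ => ?_) ?_)
    · exact le_iSup (fun i => MeasurableSpace.comap (X i) inferInstance) i
    · exact le_iSup (fun i => MeasurableSpace.comap (X i) inferInstance) (j + 1)
  · have h := indep_iSup_of_disjoint hle hX_indep (S := Set.Iic j) (T := {j + 1}) (by simp)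
    simpa using h

/-- Before the generation of packet `j + 1`, the available information is that on the private
randomness and on packets `0, …, j`. -/
theorem exists_slotFiltration_of_infoFiltration (hX0 : ∀ i ω, 0 ≤ X i ω) (j : ℕ) (t : ℝ)
    {A : Set Ω} (hA : MeasurableSet[infoFiltration 𝓡 h𝓡 X hX t] A) :
    ∃ B, MeasurableSet[slotFiltration 𝓡 h𝓡 X hX j] B ∧
      ∀ ω, t < genTime X (j + 1) ω → (ω ∈ A ↔ ω ∈ B) := by
  -- The events having a substitute on {t < t_{j+1}} form a σ-algebra, so the generators suffice.
  have hle : (infoFiltration 𝓡 h𝓡 X hX t : MeasurableSpace Ω) ≤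
      traceSpace (slotFiltration 𝓡 h𝓡 X hX j) {ω | t < genTime X (j + 1) ω} := by
    refine sup_le (fun A hA => ?_) (MeasurableSpace.generateFrom_le ?_)
    · exact ⟨A, (le_sup_left : 𝓡 ≤ slotFiltration 𝓡 h𝓡 X hX j) A hA, fun _ _ => Iff.rfl⟩
    · rintro _ ⟨i, u, hu, rfl⟩
      by_cases hij : i ≤ j
      · refine ⟨{ω | genTime X i ω ≤ u}, ?_, fun _ _ => Iff.rfl⟩
        have hg : Measurable[slotFiltration 𝓡 h𝓡 X hX j] (genTime X i) :=
          measurable_genTime_slotFiltration hij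
        exact hg (measurableSet_Iic (a := u))
      -- Packets after j have not been generated yet, so on the trace their event is empty.
      · refine ⟨∅, @MeasurableSet.empty _ (slotFiltration 𝓡 h𝓡 X hX j), fun ω hω => ?_⟩
        have h1 : genTime X (j + 1) ω ≤ genTime X i ω := genTime_mono hX0 ω (by omega)
        simp only [Set.mem_ofPred_eq, Set.mem_empty_iff_false, iff_false, not_le]
        exact hu.trans_lt (lt_of_lt_of_le hω h1)
  exact hle A hA

/-- This is where causality enters. The true delay may depend on later generations, but only its
value before the next generation matters, and up to then the decisions use packets 0, …, j and the
private randomness only. So `s` is required to be the true delay only within the slot. -/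
theorem exists_first_transmission (hX0 : ∀ i ω, 0 ≤ X i ω) {r : ℕ → Ω → WithTop ℝ}
    (hr : ∀ i, IsStoppingTime (infoFiltration 𝓡 h𝓡 X hX) (r i)) (j : ℕ) :
    ∃ s : Ω → ℝ≥0∞, Measurable[slotFiltration 𝓡 h𝓡 X hX j] s ∧ ∀ ω,
      (s ω < ENNReal.ofReal (X (j + 1) ω) →
        ∃ k, (genTime X j ω : WithTop ℝ) ≤ r k ω ∧ r k ω < (genTime X (j + 1) ω : WithTop ℝ)) ∧
      ∀ k (t : ℝ), (genTime X j ω : WithTop ℝ) ≤ r k ω → r k ω ≤ (t : WithTop ℝ) →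
        t < genTime X (j + 1) ω → s ω ≤ ENNReal.ofReal (t - genTime X j ω) := by
  classical
  -- The event that some packet is transmitted in [t_j, p]. The condition t_j ≤ r_k is phrased as
  -- "no rational u < p satisfies r_k ≤ u < t_j", which involves information up to time p only.
  let A : ℚ → Set Ω := fun p => {ω | genTime X j ω ≤ p} ∩ ⋃ k, ({ω | r k ω ≤ ((p : ℝ) : WithTop ℝ)} \
    ⋃ u : {u : ℚ // u < p},
      ({ω | r k ω ≤ (((u : ℚ) : ℝ) : WithTop ℝ)} \ {ω | genTime X j ω ≤ ((u : ℚ) : ℝ)}))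
  have hgen : ∀ u : ℝ, MeasurableSet[infoFiltration 𝓡 h𝓡 X hX u] {ω | genTime X j ω ≤ u} :=
    fun u => (le_sup_right : _ ≤ infoFiltration 𝓡 h𝓡 X hX u) _
      (MeasurableSpace.measurableSet_generateFrom ⟨j, u, le_rfl, rfl⟩)
  have hA : ∀ p : ℚ, MeasurableSet[infoFiltration 𝓡 h𝓡 X hX p] (A p) := by
    intro p
    refine MeasurableSet.inter (hgen p) (MeasurableSet.iUnion fun k => (hr k p).diff
      (MeasurableSet.iUnion fun u => ?_))
    have hup : ((u : ℚ) : ℝ) ≤ p := by exact_mod_cast u.2.le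
    exact (infoFiltration 𝓡 h𝓡 X hX).mono hup _ ((hr k _).diff (hgen _))
  have hmemA : ∀ p ω, ω ∈ A p ↔ genTime X j ω ≤ p ∧
      ∃ k, (genTime X j ω : WithTop ℝ) ≤ r k ω ∧ r k ω ≤ ((p : ℝ) : WithTop ℝ) := by
    intro p ω
    simp only [A, Set.mem_inter_iff, Set.mem_ofPred_eq, Set.mem_iUnion, Set.mem_sdiff, not_exists,
      not_and, not_not, Subtype.forall]
    refine and_congr_right fun hp => exists_congr fun k => ?_
    rw [and_comm]
    refine and_congr_left fun hrk => ?_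
    constructor
    · intro h
      by_contra hlt
      rw [not_le] at hlt
      obtain ⟨v, hv⟩ := WithTop.ne_top_iff_exists.1 (hlt.trans_le le_top).ne
      rw [← hv, WithTop.coe_lt_coe] at hlt
      obtain ⟨u, hu1, hu2⟩ := exists_rat_btwn hlt
      have h1 := h u (by exact_mod_cast hu2.trans_le hp)
        (by rw [← hv]; exact WithTop.coe_le_coe.2 hu1.le)
      linarith
    · intro h u _ hru
      exact WithTop.coe_le_coe.1 (h.trans hru)
  choose B hB hAB using fun p : ℚ => exists_slotFiltration_of_infoFiltration hX0 j (p : ℝ) (hA p)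
  -- `B p` replaces `A p` by an event known at stage j; rational times keep the infimum countable.
  let s : Ω → ℝ≥0∞ := fun ω => ⨅ p : ℚ, if ω ∈ B p ∩ {ω | genTime X j ω ≤ p} then
    ENNReal.ofReal (p - genTime X j ω) else ⊤
  have hg : Measurable[slotFiltration 𝓡 h𝓡 X hX j] (genTime X j) :=
    measurable_genTime_slotFiltration le_rfl
  refine ⟨s, ?_, fun ω => ⟨fun hs => ?_, fun k t hk1 hk2 ht => ?_⟩⟩
  · refine Measurable.iInf fun p => Measurable.ite ((hB p).inter ?_) ?_ measurable_const
    · exact hg measurableSet_Iic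
    · exact ENNReal.measurable_ofReal.comp (hg.const_sub _)
  · obtain ⟨p, hp⟩ := iInf_lt_iff.1 hs
    by_cases hmem : ω ∈ B p ∩ {ω | genTime X j ω ≤ p}
    · rw [if_pos hmem] at hp
      have hlt : (p : ℝ) < genTime X (j + 1) ω := by
        have := (ENNReal.ofReal_lt_ofReal_iff_of_nonneg (sub_nonneg.2 hmem.2)).1 hp
        rw [genTime_succ]; linarith
      obtain ⟨-, k, hk1, hk2⟩ := (hmemA p ω).1 ((hAB p ω hlt).2 hmem.1)
      exact ⟨k, hk1, hk2.trans_lt (WithTop.coe_lt_coe.2 hlt)⟩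
    · rw [if_neg hmem] at hp
      exact absurd hp not_top_lt
  · by_contra hlt
    rw [not_le] at hlt
    have hjt : genTime X j ω ≤ t := WithTop.coe_le_coe.1 (hk1.trans hk2)
    obtain ⟨u, hu0, hu1, hu2⟩ := ENNReal.lt_iff_exists_real_btwn.1 hlt
    have hu1' := (ENNReal.ofReal_lt_ofReal_iff_of_nonneg (sub_nonneg.2 hjt)).1 hu1
    -- With t − t_j < u < s, a rational p just after t, still inside the slot and below t_j + u,
    -- takes part in the infimum and forces s ≤ u.
    obtain ⟨p, hp1, hp2⟩ := exists_rat_btwn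
      (lt_min ht (by linarith : t < genTime X j ω + u))
    have hjp : genTime X j ω ≤ p := hjt.trans hp1.le
    have hp3 := hp2.trans_le (min_le_left _ _)
    have hp4 := hp2.trans_le (min_le_right _ _)
    have hpA : ω ∈ A p := (hmemA p ω).2
      ⟨hjp, k, hk1, hk2.trans (WithTop.coe_le_coe.2 hp1.le)⟩
    have hpB : ω ∈ B p := (hAB p ω hp3).1 hpA
    have hsle : s ω ≤ ENNReal.ofReal (p - genTime X j ω) := by
      refine (iInf_le _ p).trans ?_
      rw [if_pos ⟨hpB, hjp⟩]
    have := hsle.trans (ENNReal.ofReal_le_ofReal (by linarith : (p : ℝ) - genTime X j ω ≤ u))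
    exact absurd hu2 (not_lt.2 this)

end Causal

/-! ### Age and transmissions along a sample path -/

section Path

variable {Ω : Type*} {X : ℕ → Ω → ℝ} {r : ℕ → Ω → WithTop ℝ} {ω : Ω}

theorem latestReceived_le {t b : ℝ} (hb : 0 ≤ b)
    (h : ∀ i, r i ω ≤ (t : WithTop ℝ) → genTime X i ω ≤ b) : latestReceived X r t ω ≤ b := by
  refine csSup_le ⟨0, Or.inl rfl⟩ ?_
  rintro x (rfl | ⟨i, hi, rfl⟩)
  · exact hb
  · exact h i hi

theorem bddAbove_received (hge : ∀ i, (genTime X i ω : WithTop ℝ) ≤ r i ω) (t : ℝ) :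
    BddAbove ({0} ∪ {x : ℝ | ∃ i : ℕ, r i ω ≤ (t : WithTop ℝ) ∧ x = genTime X i ω}) := by
  refine ⟨max 0 t, ?_⟩
  rintro x (rfl | ⟨i, hi, rfl⟩)
  · exact le_max_left _ _
  · exact (WithTop.coe_le_coe.1 ((hge i).trans hi)).trans (le_max_right _ _)

theorem le_latestReceived (hge : ∀ i, (genTime X i ω : WithTop ℝ) ≤ r i ω) {t : ℝ} {i : ℕ}
    (hi : r i ω ≤ (t : WithTop ℝ)) : genTime X i ω ≤ latestReceived X r t ω :=
  le_csSup (bddAbove_received hge t) (Or.inr ⟨i, hi, rfl⟩)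

theorem latestReceived_nonneg (hge : ∀ i, (genTime X i ω : WithTop ℝ) ≤ r i ω) (t : ℝ) :
    0 ≤ latestReceived X r t ω :=
  le_csSup (bddAbove_received hge t) (Or.inl rfl)

theorem latestReceived_mono (hge : ∀ i, (genTime X i ω : WithTop ℝ) ≤ r i ω) :
    Monotone fun t => latestReceived X r t ω := fun _ t' htt' =>
  latestReceived_le (latestReceived_nonneg hge t') fun _ hi =>
    le_latestReceived hge (hi.trans (WithTop.coe_le_coe.2 htt'))

theorem age_nonneg (hge : ∀ i, (genTime X i ω : WithTop ℝ) ≤ r i ω) {t : ℝ} (ht : 0 ≤ t) :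
    0 ≤ age X r t ω :=
  sub_nonneg.2 (latestReceived_le ht fun i hi => WithTop.coe_le_coe.1 ((hge i).trans hi))

theorem intervalIntegrable_age (hge : ∀ i, (genTime X i ω : WithTop ℝ) ≤ r i ω) (a b : ℝ) :
    IntervalIntegrable (fun t => age X r t ω) volume a b :=
  intervalIntegral.intervalIntegrable_id.sub (latestReceived_mono hge).intervalIntegrable

theorem finite_transmitted (hge : ∀ i, (genTime X i ω : WithTop ℝ) ≤ r i ω)
    (htop : Tendsto (fun i => genTime X i ω) atTop atTop) (t : ℝ) :
    {i : ℕ | r i ω ≤ (t : WithTop ℝ)}.Finite := by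
  obtain ⟨N, hN⟩ := eventually_atTop.1 (htop.eventually_gt_atTop t)
  refine (Set.finite_lt_nat N).subset fun i hi => ?_
  by_contra hlt
  exact absurd (WithTop.coe_le_coe.1 ((hge i).trans hi)) (not_le.2 (hN i (not_lt.1 hlt)))

/-- The accumulated cost up to time `t`. -/
noncomputable def accCost (κ : ℝ) (X : ℕ → Ω → ℝ) (r : ℕ → Ω → WithTop ℝ) (t : ℝ) (ω : Ω) : ℝ :=
  κ * numTx r t ω + ∫ u in (0 : ℝ)..t, age X r u ω

theorem totalCost_eq (ρ c : ℝ) (t : ℝ) :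
    totalCost ρ c X r t ω = accCost (ρ * c) X r t ω / t := by
  unfold totalCost avgTxCost avgAge accCost; ring

theorem accCost_mono {κ : ℝ} (hκ : 0 ≤ κ) (hge : ∀ i, (genTime X i ω : WithTop ℝ) ≤ r i ω)
    (htop : Tendsto (fun i => genTime X i ω) atTop atTop) {t t' : ℝ} (ht : 0 ≤ t) (h : t ≤ t') :
    accCost κ X r t ω ≤ accCost κ X r t' ω := by
  refine add_le_add (mul_le_mul_of_nonneg_left ?_ hκ) ?_
  · refine Nat.cast_le.2 (Set.ncard_le_ncard (fun i hi => ?_) (finite_transmitted hge htop t'))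
    exact le_trans hi (WithTop.coe_le_coe.2 h)
  · rw [← intervalIntegral.integral_add_adjacent_intervals (intervalIntegrable_age hge 0 t)
      (intervalIntegrable_age hge t t')]
    have := intervalIntegral.integral_nonneg (μ := volume) h
      (fun u hu => age_nonneg (X := X) (r := r) (ω := ω) hge (ht.trans hu.1))
    linarith

theorem accCost_nonneg {κ : ℝ} (hκ : 0 ≤ κ) (hge : ∀ i, (genTime X i ω : WithTop ℝ) ≤ r i ω)
    {t : ℝ} (ht : 0 ≤ t) : 0 ≤ accCost κ X r t ω :=
  add_nonneg (by positivity)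
    (intervalIntegral.integral_nonneg ht fun _ hu => age_nonneg hge hu.1)

/-- Lower bound, truncated at `θ`, for the age just before the generation of packet `j`, when `s j`
is the delay between the generation of packet `j` and the first transmission thereafter. -/
noncomputable def ageBound (θ : ℝ) (X : ℕ → Ω → ℝ) (s : ℕ → Ω → ℝ≥0∞) : ℕ → Ω → ℝ
  | 0, _ => 0
  | j + 1, ω => min θ (if s j ω < ENNReal.ofReal (X (j + 1) ω) then X (j + 1) ω
      else X (j + 1) ω + ageBound θ X s j ω)

/-- `s j` is the delay between the generation of packet `j` and the first transmission thereafter,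
if this transmission takes place before the next generation. -/
def IsFirstDelay (X : ℕ → Ω → ℝ) (r : ℕ → Ω → WithTop ℝ) (s : ℕ → Ω → ℝ≥0∞) (ω : Ω) : Prop :=
  ∀ j, (s j ω < ENNReal.ofReal (X (j + 1) ω) →
        ∃ k, (genTime X j ω : WithTop ℝ) ≤ r k ω ∧ r k ω < (genTime X (j + 1) ω : WithTop ℝ)) ∧
      ∀ k (t : ℝ), (genTime X j ω : WithTop ℝ) ≤ r k ω → r k ω ≤ (t : WithTop ℝ) →
        t < genTime X (j + 1) ω → s j ω ≤ ENNReal.ofReal (t - genTime X j ω)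

variable {θ β κ : ℝ} {s : ℕ → Ω → ℝ≥0∞}

theorem ageBound_mem (hX0 : ∀ i ω, 0 ≤ X i ω) (hθ : 0 ≤ θ) (j : ℕ) (ω : Ω) :
    ageBound θ X s j ω ∈ Set.Icc 0 θ := by
  induction j with
  | zero => exact ⟨le_rfl, hθ⟩
  | succ j ih =>
    refine ⟨le_min hθ ?_, min_le_left _ _⟩
    have := hX0 (j + 1) ω
    have := ih.1
    split_ifs <;> linarith

theorem measurable_ageBound {𝓡 : MeasurableSpace Ω} [mΩ : MeasurableSpace Ω] {h𝓡 : 𝓡 ≤ mΩ}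
    {hX : ∀ i, Measurable (X i)} (hs : ∀ j, Measurable[slotFiltration 𝓡 h𝓡 X hX j] (s j)) (j : ℕ) :
    Measurable[slotFiltration 𝓡 h𝓡 X hX j] (ageBound θ X s j) := by
  induction j with
  | zero => exact measurable_const
  | succ j ih =>
    have hle : (slotFiltration 𝓡 h𝓡 X hX j : MeasurableSpace Ω) ≤
      slotFiltration 𝓡 h𝓡 X hX (j + 1) := (slotFiltration 𝓡 h𝓡 X hX).mono j.le_succ
    have h1 : Measurable[slotFiltration 𝓡 h𝓡 X hX (j + 1)] (X (j + 1)) :=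
      measurable_slotFiltration le_rfl
    have h2 : Measurable[slotFiltration 𝓡 h𝓡 X hX (j + 1)] (s j) := (hs j).mono hle le_rfl
    have h3 : Measurable[slotFiltration 𝓡 h𝓡 X hX (j + 1)] (ageBound θ X s j) := ih.mono hle le_rfl
    exact measurable_const.min (Measurable.ite
      (measurableSet_lt h2 (ENNReal.measurable_ofReal.comp h1)) h1 (h1.add h3))

/-- This makes `ageBound` a lower bound for the age. If something is sent in slot j, everything
received before t_{j+1} was still generated by t_j; if nothing is sent there, whatever has been
received was received before t_j. Truncation at θ only weakens the bound. -/
theorem genTime_le_sub_ageBound (hX0 : ∀ i ω, 0 ≤ X i ω)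
    (hge : ∀ i, (genTime X i ω : WithTop ℝ) ≤ r i ω) (hs : IsFirstDelay X r s ω) (j : ℕ) :
    0 ≤ genTime X j ω - ageBound θ X s j ω ∧
      ∀ k, r k ω < (genTime X j ω : WithTop ℝ) →
        genTime X k ω ≤ genTime X j ω - ageBound θ X s j ω := by
  have hlt : ∀ j k, r k ω < (genTime X j ω : WithTop ℝ) → k < j := by
    intro j k h
    by_contra hjk
    have h1 := WithTop.coe_lt_coe.1 ((hge k).trans_lt h)
    have h2 : genTime X j ω ≤ genTime X k ω := genTime_mono hX0 ω (not_lt.1 hjk)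
    linarith
  induction j with
  | zero =>
    simp only [ageBound, sub_zero]
    exact ⟨genTime_nonneg hX0 0 ω, fun k hk => absurd (hlt 0 k hk) (by omega)⟩
  | succ j ih =>
    have h1 : ageBound θ X s (j + 1) ω ≤ if s j ω < ENNReal.ofReal (X (j + 1) ω) then X (j + 1) ω
      else X (j + 1) ω + ageBound θ X s j ω := min_le_right _ _
    have h2 := genTime_succ X j ω
    by_cases hsj : s j ω < ENNReal.ofReal (X (j + 1) ω)
    · rw [if_pos hsj] at h1
      refine ⟨by linarith [genTime_nonneg hX0 j ω], fun k hk => ?_⟩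
      have h3 : genTime X k ω ≤ genTime X j ω :=
        genTime_mono hX0 ω (Nat.lt_succ_iff.1 (hlt (j + 1) k hk))
      linarith
    · rw [if_neg hsj] at h1
      refine ⟨by linarith [ih.1], fun k hk => ?_⟩
      have h3 : r k ω < (genTime X j ω : WithTop ℝ) := by
        by_contra hkj
        rw [not_lt] at hkj
        obtain ⟨v, hv⟩ := WithTop.ne_top_iff_exists.1 (hk.trans_le le_top).ne
        rw [← hv] at hk hkj
        have hk' := WithTop.coe_lt_coe.1 hk
        have hkj' := WithTop.coe_le_coe.1 hkj
        have h4 := (hs j).2 k v (hv ▸ hkj) hv.ge hk'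
        refine hsj (h4.trans_lt ((ENNReal.ofReal_lt_ofReal_iff (by linarith)).2 (by linarith)))
      linarith [ih.2 k h3]

/-- Until the first transmission the age is at least x plus the time since t_j; afterwards it is at
least that time, packet j being the newest available. -/
theorem integral_age_slot_ge (hX0 : ∀ i ω, 0 ≤ X i ω)
    (hge : ∀ i, (genTime X i ω : WithTop ℝ) ≤ r i ω) (hs : IsFirstDelay X r s ω) (j : ℕ) :
    X (j + 1) ω ^ 2 / 2 + ageBound θ X s j ω *
        (min (s j ω) (ENNReal.ofReal (X (j + 1) ω))).toReal ≤
      ∫ t in genTime X j ω..genTime X (j + 1) ω, age X r t ω := by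
  set m := (min (s j ω) (ENNReal.ofReal (X (j + 1) ω))).toReal with hm
  set x := ageBound θ X s j ω with hx
  set a := genTime X j ω with ha
  obtain ⟨hm0, hm1⟩ := min_ofReal_toReal_mem (s := s j ω) (hX0 (j + 1) ω)
  rw [← hm] at hm0 hm1
  have hb : genTime X (j + 1) ω = a + X (j + 1) ω := genTime_succ X j ω
  have hinv := genTime_le_sub_ageBound (θ := θ) hX0 hge hs j
  rw [← intervalIntegral.integral_add_adjacent_intervals (intervalIntegrable_age hge a (a + m))
    (intervalIntegrable_age hge (a + m) _)]
  have h1 : ∫ t in a..(a + m), (t - (a - x)) ≤ ∫ t in a..(a + m), age X r t ω := by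
    refine intervalIntegral.integral_mono_on_of_le_Ioo (by linarith)
      (Continuous.intervalIntegrable (by fun_prop) _ _) (intervalIntegrable_age hge _ _)
      fun t ht => sub_le_sub_left (latestReceived_le hinv.1 fun k hk => ?_) t
    by_cases hka : r k ω < (a : WithTop ℝ)
    · exact hinv.2 k hka
    · have h2 := (hs j).2 k t (not_lt.1 hka) hk (by linarith [ht.2])
      have h3 : ENNReal.ofReal (t - a) < min (s j ω) (ENNReal.ofReal (X (j + 1) ω)) :=
        (ENNReal.ofReal_lt_iff_lt_toReal (by linarith [ht.1])
          (min_lt_of_right_lt ENNReal.ofReal_lt_top).ne).2 (by linarith [ht.2])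
      exact absurd h2 (not_le.2 (h3.trans_le (min_le_left _ _)))
  have h2 : ∫ t in (a + m)..genTime X (j + 1) ω, (t - a) ≤
      ∫ t in (a + m)..genTime X (j + 1) ω, age X r t ω := by
    refine intervalIntegral.integral_mono_on_of_le_Ioo (by linarith)
      (Continuous.intervalIntegrable (by fun_prop) _ _) (intervalIntegrable_age hge _ _)
      fun t ht => sub_le_sub_left (latestReceived_le (genTime_nonneg hX0 j ω) fun k hk => ?_) t
    refine genTime_mono hX0 ω ?_
    by_contra hjk
    have h3 : genTime X (j + 1) ω ≤ genTime X k ω := genTime_mono hX0 ω (by omega)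
    have h4 := WithTop.coe_le_coe.1 ((hge k).trans hk)
    linarith [ht.2]
  have e1 : ∫ t in a..(a + m), (t - (a - x)) = m ^ 2 / 2 + x * m := by
    rw [intervalIntegral.integral_sub intervalIntegral.intervalIntegrable_id (by simp)]
    simp only [integral_id, intervalIntegral.integral_const, smul_eq_mul]; ring
  have e2 : ∫ t in (a + m)..genTime X (j + 1) ω, (t - a) =
      X (j + 1) ω ^ 2 / 2 - m ^ 2 / 2 := by
    rw [intervalIntegral.integral_sub intervalIntegral.intervalIntegrable_id (by simp), hb]
    simp only [integral_id, intervalIntegral.integral_const, smul_eq_mul]; ring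
  linarith

/-- Each marked slot contains a transmission, and the slots [t_j, t_{j+1}) are disjoint. The strict
inequality in the count fits these half-open slots. -/
theorem sum_indicator_le_ncard (hX0 : ∀ i ω, 0 ≤ X i ω)
    (hge : ∀ i, (genTime X i ω : WithTop ℝ) ≤ r i ω)
    (htop : Tendsto (fun i => genTime X i ω) atTop atTop) (hκ : 0 ≤ κ)
    (hs : IsFirstDelay X r s ω) (n : ℕ) :
    ∑ j ∈ Finset.range n, (if s j ω < ENNReal.ofReal (X (j + 1) ω) then κ else 0) ≤
      κ * ({k : ℕ | r k ω < (genTime X n ω : WithTop ℝ)}.ncard : ℝ) := by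
  have hfin : ∀ t : ℝ, {k : ℕ | r k ω < (t : WithTop ℝ)}.Finite := fun t =>
    (finite_transmitted hge htop t).subset fun k (hk : r k ω < _) => hk.le
  induction n with
  | zero => simp only [Finset.range_zero, Finset.sum_empty]; positivity
  | succ n ih =>
    rw [Finset.sum_range_succ]
    have hsub : {k : ℕ | r k ω < (genTime X n ω : WithTop ℝ)} ⊆
        {k : ℕ | r k ω < (genTime X (n + 1) ω : WithTop ℝ)} := fun k hk =>
      lt_of_lt_of_le hk (WithTop.coe_le_coe.2 (genTime_mono hX0 ω n.le_succ))
    split_ifs with h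
    · obtain ⟨k, hk1, hk2⟩ := (hs n).1 h
      have hlt := Set.ncard_lt_ncard (hsub.ssubset_of_mem_notMem hk2 (not_lt.2 hk1)) (hfin _)
      have : (({k : ℕ | r k ω < (genTime X n ω : WithTop ℝ)}.ncard : ℝ)) + 1 ≤
          ({k : ℕ | r k ω < (genTime X (n + 1) ω : WithTop ℝ)}.ncard : ℝ) := by exact_mod_cast hlt
      nlinarith
    · have hle := Set.ncard_le_ncard hsub (hfin _)
      have := mul_le_mul_of_nonneg_left (Nat.cast_le (α := ℝ).2 hle) hκ
      linarith

/-- Along every sample path the accumulated cost is bounded below by the slot costs. -/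
theorem accCost_ge (hX0 : ∀ i ω, 0 ≤ X i ω)
    (hge : ∀ i, (genTime X i ω : WithTop ℝ) ≤ r i ω)
    (htop : Tendsto (fun i => genTime X i ω) atTop atTop) (hθ : 0 ≤ θ) (hθβ : θ ≤ β)
    (hκ : κ = β * θ - θ ^ 2 / 2) (hs : IsFirstDelay X r s ω) {n : ℕ} {t : ℝ}
    (ht : genTime X n ω ≤ t) :
    β * (genTime X n ω - genTime X 0 ω) - κ + ∑ j ∈ Finset.range n,
      slotCost β θ κ (ageBound θ X s j ω) (s j ω) (X (j + 1) ω) ≤ accCost κ X r t ω := by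
  have hκ0 : 0 ≤ κ := by rw [hκ, ← ageValue_of_ge (β := β) le_rfl]; exact ageValue_nonneg hθ hθβ hθ
  have ht0 : genTime X 0 ω ≤ genTime X n ω := genTime_mono hX0 ω n.zero_le
  have h00 := genTime_nonneg hX0 0 ω
  refine le_trans ?_ (accCost_mono hκ0 hge htop (h00.trans ht0) ht)
  have hint : ∀ n, ∑ j ∈ Finset.range n, (X (j + 1) ω ^ 2 / 2 + ageBound θ X s j ω *
        (min (s j ω) (ENNReal.ofReal (X (j + 1) ω))).toReal) ≤
      ∫ t in (0 : ℝ)..genTime X n ω, age X r t ω := by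
    intro n
    induction n with
    | zero =>
      simp only [Finset.range_zero, Finset.sum_empty]
      exact intervalIntegral.integral_nonneg h00 fun t ht => age_nonneg hge ht.1
    | succ n ih =>
      rw [Finset.sum_range_succ, ← intervalIntegral.integral_add_adjacent_intervals
        (intervalIntegrable_age hge 0 (genTime X n ω)) (intervalIntegrable_age hge _ _)]
      exact add_le_add ih (integral_age_slot_ge hX0 hge hs n)
  have hnum : ∑ j ∈ Finset.range n, (if s j ω < ENNReal.ofReal (X (j + 1) ω) then κ else 0) ≤
      κ * numTx r (genTime X n ω) ω := by
    refine (sum_indicator_le_ncard hX0 hge htop hκ0 hs n).trans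
      (mul_le_mul_of_nonneg_left (Nat.cast_le.2 ?_) hκ0)
    exact Set.ncard_le_ncard (fun k (hk : r k ω < _) => hk.le) (finite_transmitted hge htop _)
  -- The increments of the potential telescope, because `ageBound` follows the age update in
  -- `slotCost` up to truncation. The remaining final value is at most κ.
  have hsum : ∀ n, ∑ j ∈ Finset.range n,
      slotCost β θ κ (ageBound θ X s j ω) (s j ω) (X (j + 1) ω) =
      ∑ j ∈ Finset.range n, (X (j + 1) ω ^ 2 / 2 + ageBound θ X s j ω *
        (min (s j ω) (ENNReal.ofReal (X (j + 1) ω))).toReal) +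
      ∑ j ∈ Finset.range n, (if s j ω < ENNReal.ofReal (X (j + 1) ω) then κ else 0)
      - β * (genTime X n ω - genTime X 0 ω) + ageValue β θ (ageBound θ X s n ω) := by
    intro n
    induction n with
    | zero => simp [ageBound, ageValue_zero hθ]
    | succ n ih =>
      rw [Finset.sum_range_succ, Finset.sum_range_succ, Finset.sum_range_succ, ih, genTime_succ]
      simp only [slotCost, ageBound, ageValue_min]
      ring
  have hw := ageValue_le hθβ (ageBound θ X s n ω)
  have := hint n
  rw [hsum]
  unfold accCost
  linarith

end Path

/-! ### No causal policy beats the threshold policy -/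

section Interpolation

theorem eventually_exists_mem_Ico {τ : ℕ → ℝ} (hτ : Tendsto τ atTop atTop) (N : ℕ) :
    ∀ᶠ t in atTop, 0 < t ∧ ∃ n, N ≤ n ∧ τ n ≤ t ∧ t < τ (n + 1) := by
  filter_upwards [eventually_ge_atTop (τ N), eventually_gt_atTop 0] with t ht ht0
  refine ⟨ht0, ?_⟩
  classical
  have hex : ∃ k, t < τ (N + k) := by
    obtain ⟨m, hm⟩ := ((tendsto_add_atTop_iff_nat N).2 hτ |>.eventually_gt_atTop t).exists
    exact ⟨m, by rwa [add_comm]⟩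
  have hk := Nat.find_spec hex
  have hmin := fun m => Nat.find_min (m := m) hex
  rcases hk0 : Nat.find hex with _ | k
  · rw [hk0, add_zero] at hk; linarith
  · rw [hk0] at hk
    exact ⟨N + k, by omega, not_lt.1 (hmin k (by omega)), hk⟩

/-- Passes from bounds on the intervals [τ n, τ (n+1)) to continuous time. The values are in
`EReal`, where the lower limit is meaningful without any boundedness. -/
theorem le_liminf_of_interpolation {τ g : ℕ → ℝ} {f : ℝ → ℝ} {β : ℝ}
    (hτ : Tendsto τ atTop atTop) (hg : Tendsto g atTop (𝓝 β))
    (h : ∀ n t, 0 < t → τ n ≤ t → t < τ (n + 1) → g n ≤ f t) :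
    (β : EReal) ≤ liminf (fun t => (f t : EReal)) atTop := by
  rw [le_liminf_iff]
  intro y hy
  have hg' : Tendsto (fun n => (g n : EReal)) atTop (𝓝 (β : EReal)) :=
    (continuous_coe_real_ereal.tendsto β).comp hg
  obtain ⟨N, hN⟩ := eventually_atTop.1 (hg'.eventually (lt_mem_nhds hy))
  filter_upwards [eventually_exists_mem_Ico hτ N] with t ht
  obtain ⟨ht0, n, hn, h1, h2⟩ := ht
  exact (hN n hn).trans_le (EReal.coe_le_coe_iff.2 (h n t ht0 h1 h2))

theorem eventually_lt_of_interpolation {τ g : ℕ → ℝ} {f : ℝ → ℝ} {β b : ℝ}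
    (hτ : Tendsto τ atTop atTop) (hg : Tendsto g atTop (𝓝 β)) (hb : β < b)
    (h : ∀ n t, 0 < t → τ n ≤ t → t < τ (n + 1) → f t ≤ g n) : ∀ᶠ t in atTop, f t < b := by
  obtain ⟨N, hN⟩ := eventually_atTop.1 (hg.eventually (gt_mem_nhds hb))
  filter_upwards [eventually_exists_mem_Ico hτ N] with t ht
  obtain ⟨ht0, n, hn, h1, h2⟩ := ht
  exact (h n t ht0 h1 h2).trans_lt (hN n hn)

end Interpolation

section LowerBound

variable {Ω : Type*} {X : ℕ → Ω → ℝ} {q : ℝ}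

theorem ae_tendsto_genTime_div [MeasurableSpace Ω] {μ : Measure Ω} (hq : 0 < q) (hX : ∀ i, Measurable (X i))
    (hX_indep : iIndepFun X μ) (hX_law : ∀ i, μ.map (X i) = expMeasure q) :
    ∀ᵐ ω ∂μ, Tendsto (fun n : ℕ => genTime X n ω / n) atTop (𝓝 (1 / q)) := by
  have hint : Integrable (X 0) μ := by
    have h : Integrable (fun x : ℝ => x) (μ.map (X 0)) := by
      rw [hX_law]; exact integrable_id_expMeasure hq
    exact h.comp_measurable (hX 0)
  have hmean : ∫ ω, X 0 ω ∂μ = 1 / q := by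
    have h : ∫ x, x ∂(μ.map (X 0)) = ∫ ω, X 0 ω ∂μ :=
      integral_map (hX 0).aemeasurable (by fun_prop)
    rw [← h, hX_law, integral_id_expMeasure hq]
  have hslln := strong_law_ae_real X hint (fun i j hij => hX_indep.indepFun hij)
    fun i => ⟨(hX i).aemeasurable, (hX 0).aemeasurable, by rw [hX_law, hX_law]⟩
  rw [hmean] at hslln
  filter_upwards [hslln] with ω hω
  have h1 : Tendsto (fun n : ℕ => genTime X n ω / ((n + 1 : ℕ) : ℝ)) atTop (𝓝 (1 / q)) :=
    (tendsto_add_atTop_iff_nat 1).2 hω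
  -- `genTime X n` has n + 1 summands; this factor changes the denominator n + 1 to n.
  have h2 : Tendsto (fun n : ℕ => 1 + 1 / (n : ℝ)) atTop (𝓝 (1 + 0)) :=
    tendsto_const_nhds.add tendsto_one_div_atTop_nhds_zero_nat
  have h3 := h1.mul h2
  rw [add_zero, mul_one] at h3
  refine h3.congr' ?_
  filter_upwards [eventually_gt_atTop 0] with n hn
  push_cast
  field_simp

theorem tendsto_genTime_atTop {ω : Ω} (hq : 0 < q)
    (h : Tendsto (fun n : ℕ => genTime X n ω / n) atTop (𝓝 (1 / q))) :
    Tendsto (fun n => genTime X n ω) atTop atTop := by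
  refine (h.pos_mul_atTop (by positivity) tendsto_natCast_atTop_atTop).congr' ?_
  filter_upwards [eventually_gt_atTop 0] with n hn
  have : (n : ℝ) ≠ 0 := by positivity
  field_simp

/-- The pathwise bound `accCost_ge` is combined with the asymptotic nonnegativity of the summed slot
costs: by generation N the accumulated cost is at least β t_N − o(N), and t_N grows like N/q. -/
theorem ae_le_liminf_totalCost {𝓡 : MeasurableSpace Ω} [mΩ : MeasurableSpace Ω] {h𝓡 : 𝓡 ≤ mΩ}
    {μ : Measure Ω} [IsProbabilityMeasure μ] {ρ c θ β : ℝ} (hq : 0 < q) (hθ : 0 ≤ θ)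
    (hβ : β = θ + 1 / q) (hκ : ρ * c = β * θ - θ ^ 2 / 2) {hX : ∀ i, Measurable (X i)}
    (hX0 : ∀ i ω, 0 ≤ X i ω) (hX_indep : iIndepFun X μ)
    (hX_law : ∀ i, μ.map (X i) = expMeasure q)
    (h𝓡_indep : Indep 𝓡 (⨆ i, MeasurableSpace.comap (X i) inferInstance) μ)
    {r : ℕ → Ω → WithTop ℝ} (hr : IsCausal 𝓡 h𝓡 X hX r) :
    ∀ᵐ ω ∂μ, (β : EReal) ≤ liminf (fun t : ℝ => ((totalCost ρ c X r t ω : ℝ) : EReal)) atTop := by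
  have hq' : 0 < 1 / q := by positivity
  have hθβ : θ ≤ β := by linarith
  have hκ0 : 0 ≤ ρ * c := by
    rw [hκ, ← ageValue_of_ge (β := β) le_rfl]; exact ageValue_nonneg hθ hθβ hθ
  choose s hsm hs using fun j => exists_first_transmission (h𝓡 := h𝓡) (hX := hX) hX0 hr.2 j
  have hlln := ae_sum_slotCost_ge (μ := μ) hq hθ hβ hκ (slotFiltration 𝓡 h𝓡 X hX)
    (x := ageBound θ X s) (s := s) (L := fun j => X (j + 1)) (fun j => measurable_ageBound hsm j)
    hsm (fun j => measurable_slotFiltration le_rfl) (fun j => hX0 (j + 1))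
    (fun j ω => ageBound_mem hX0 hθ j ω) (fun j => indep_slotFiltration hX_indep h𝓡_indep j)
    (fun j => hX_law (j + 1))
  filter_upwards [hlln, ae_tendsto_genTime_div hq hX hX_indep hX_law] with ω hω hgen
  obtain ⟨e, he, hsum⟩ := hω
  have htop := tendsto_genTime_atTop hq hgen
  have hsq : Tendsto (fun n : ℕ => n ^ 2) atTop atTop := tendsto_pow_atTop two_ne_zero
  set τ : ℕ → ℝ := fun n => genTime X (n ^ 2) ω with hτ
  have hτtop : Tendsto τ atTop atTop := htop.comp hsq
  set num : ℕ → ℝ := fun n => β * (τ n - genTime X 0 ω) - ρ * c + e n * (n : ℝ) ^ 2 with hnum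
  have hτdiv : Tendsto (fun n : ℕ => τ n / (n : ℝ) ^ 2) atTop (𝓝 (1 / q)) := by
    have := hgen.comp hsq
    simpa [Function.comp_def, hτ] using this
  have hn2 : Tendsto (fun n : ℕ => ((n : ℝ) ^ 2)⁻¹) atTop (𝓝 0) :=
    tendsto_inv_atTop_zero.comp
      ((tendsto_pow_atTop two_ne_zero).comp tendsto_natCast_atTop_atTop)
  have hnumdiv : Tendsto (fun n : ℕ => num n / (n : ℝ) ^ 2) atTop (𝓝 (β * (1 / q))) := by
    have h1 := ((hτdiv.const_mul β).sub (hn2.const_mul (β * genTime X 0 ω + ρ * c))).add he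
    rw [mul_zero, sub_zero, add_zero] at h1
    refine h1.congr' ?_
    filter_upwards [eventually_gt_atTop 0] with n hn
    simp only [hnum]
    field_simp
    ring
  have hτdiv1 : Tendsto (fun n : ℕ => τ (n + 1) / (n : ℝ) ^ 2) atTop (𝓝 (1 / q)) := by
    have h1 := (tendsto_add_atTop_iff_nat 1).2 hτdiv
    have h2 : Tendsto (fun n : ℕ => (1 + 1 / (n : ℝ)) ^ 2) atTop (𝓝 ((1 + 0) ^ 2)) :=
      (tendsto_const_nhds.add tendsto_one_div_atTop_nhds_zero_nat).pow 2
    have h3 := h1.mul h2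
    rw [add_zero, one_pow, mul_one] at h3
    refine h3.congr' ?_
    filter_upwards [eventually_gt_atTop 0] with n hn
    push_cast
    field_simp
  -- Between consecutive sampling times the cost is bounded below at the left end and the time above
  -- at the right end; the loss vanishes as (n+1)²/n² tends to 1.
  have hg : Tendsto (fun n => num n / τ (n + 1)) atTop (𝓝 β) := by
    have h1 := hnumdiv.div hτdiv1 hq'.ne'
    rw [mul_div_cancel_right₀ _ hq'.ne'] at h1
    refine h1.congr' ?_
    filter_upwards [eventually_gt_atTop 0] with n hn
    have : (n : ℝ) ≠ 0 := by positivity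
    simp only [Pi.div_apply]
    field_simp
  refine le_liminf_of_interpolation hτtop hg fun n t ht0 h1 h2 => ?_
  have hF := accCost_ge (r := r) (s := s) (t := t) (n := n ^ 2) hX0 (fun i => hr.1 i ω) htop hθ hθβ
    hκ (fun j => hs j ω) h1
  have hF0 := accCost_nonneg (X := X) (r := r) (ω := ω) hκ0 (fun i => hr.1 i ω) ht0.le
  have hle : num n ≤ accCost (ρ * c) X r t ω := by
    refine le_trans ?_ hF
    have := hsum n
    simp only [hnum]
    linarith
  rw [totalCost_eq]
  have hτpos : 0 < τ (n + 1) := ht0.trans h2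
  rw [div_le_div_iff₀ hτpos ht0]
  calc num n * t ≤ accCost (ρ * c) X r t ω * t := mul_le_mul_of_nonneg_right hle ht0.le
    _ ≤ accCost (ρ * c) X r t ω * τ (n + 1) := mul_le_mul_of_nonneg_left h2.le hF0

end LowerBound

/-! ### The long-run cost of a stationary non-buffering policy -/

section CyclePath

variable {Ω : Type*} {X : ℕ → Ω → ℝ} {r : ℕ → Ω → WithTop ℝ} {ω : Ω}

theorem sum_cycleLength (n : ℕ) :
    ∑ k ∈ Finset.range n, cycleLength X r k ω = cycleStart X r n ω := by
  unfold cycleLength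
  rw [Finset.sum_range_sub fun n => cycleStart X r n ω]
  simp [cycleStart]

theorem cycleLength_zero_ge (hX0 : ∀ i ω, 0 ≤ X i ω) (ω : Ω) : X 0 ω ≤ cycleLength X r 0 ω := by
  have h : genTime X 0 ω ≤ genTime X (Nat.nth (fun i => r i ω ≠ ⊤) 0) ω :=
    genTime_mono hX0 ω (Nat.zero_le _)
  simpa [cycleLength, cycleStart, genTime] using h

theorem cycleStart_nonneg (hX0 : ∀ i ω, 0 ≤ X i ω) (n : ℕ) (ω : Ω) : 0 ≤ cycleStart X r n ω := by
  cases n with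
  | zero => exact le_rfl
  | succ n => exact genTime_nonneg hX0 _ ω

theorem cycleStart_mono (hX0 : ∀ i ω, 0 ≤ X i ω) (hinf : {i : ℕ | r i ω ≠ ⊤}.Infinite) :
    Monotone fun n => cycleStart X r n ω := by
  refine monotone_nat_of_le_succ fun n => ?_
  cases n with
  | zero => exact cycleStart_nonneg hX0 1 ω
  | succ n => exact genTime_mono hX0 ω (Nat.nth_monotone hinf n.le_succ)

theorem transmitted_nth (hNB : ∀ i, r i ω = (genTime X i ω : WithTop ℝ) ∨ r i ω = ⊤)
    (hinf : {i : ℕ | r i ω ≠ ⊤}.Infinite) (n : ℕ) :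
    r (Nat.nth (fun i => r i ω ≠ ⊤) n) ω = (cycleStart X r (n + 1) ω : WithTop ℝ) :=
  (hNB _).resolve_right (Nat.nth_mem_of_infinite hinf n)

/-- Within a cycle the packet that opened it has been received, so the age is at most the time
elapsed in the cycle. -/
theorem integral_age_cycle_le (hX0 : ∀ i ω, 0 ≤ X i ω)
    (hge : ∀ i, (genTime X i ω : WithTop ℝ) ≤ r i ω)
    (hNB : ∀ i, r i ω = (genTime X i ω : WithTop ℝ) ∨ r i ω = ⊤)
    (hinf : {i : ℕ | r i ω ≠ ⊤}.Infinite) (n : ℕ) :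
    ∫ t in (0 : ℝ)..cycleStart X r n ω, age X r t ω ≤
      ∑ k ∈ Finset.range n, cycleLength X r k ω ^ 2 / 2 := by
  induction n with
  | zero => simp [cycleStart]
  | succ n ih =>
    have hle : cycleStart X r n ω ≤ cycleStart X r (n + 1) ω :=
      cycleStart_mono hX0 hinf n.le_succ
    rw [Finset.sum_range_succ, ← intervalIntegral.integral_add_adjacent_intervals
      (intervalIntegrable_age hge 0 (cycleStart X r n ω)) (intervalIntegrable_age hge _ _)]
    refine add_le_add ih ?_
    have hlatest : ∀ t, cycleStart X r n ω ≤ t → cycleStart X r n ω ≤ latestReceived X r t ω := by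
      intro t ht
      cases n with
      | zero => exact latestReceived_nonneg hge t
      | succ n =>
        exact le_latestReceived hge
          ((transmitted_nth hNB hinf n).le.trans (WithTop.coe_le_coe.2 ht))
    have h1 : ∫ t in cycleStart X r n ω..cycleStart X r (n + 1) ω, age X r t ω ≤
        ∫ t in cycleStart X r n ω..cycleStart X r (n + 1) ω, (t - cycleStart X r n ω) :=
      intervalIntegral.integral_mono_on hle (intervalIntegrable_age hge _ _)
        (Continuous.intervalIntegrable (by fun_prop) _ _)
        fun t ht => sub_le_sub_left (hlatest t ht.1) t
    refine h1.trans (le_of_eq ?_)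
    rw [intervalIntegral.integral_sub intervalIntegral.intervalIntegrable_id (by simp)]
    simp only [integral_id, intervalIntegral.integral_const, smul_eq_mul, cycleLength]; ring

/-- Strict positivity excludes simultaneous generations, which could put several transmissions at
one cycle start, or one at time 0. -/
theorem numTx_cycleStart_le (hXpos : ∀ i, 0 < X i ω)
    (hge : ∀ i, (genTime X i ω : WithTop ℝ) ≤ r i ω)
    (hinf : {i : ℕ | r i ω ≠ ⊤}.Infinite) (n : ℕ) : numTx r (cycleStart X r n ω) ω ≤ n := by
  have hmono : StrictMono fun i => genTime X i ω := strictMono_nat_of_lt_succ fun i => by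
    rw [genTime_succ]; linarith [hXpos (i + 1)]
  have hsub : {i : ℕ | r i ω ≤ (cycleStart X r n ω : WithTop ℝ)} ⊆
      (Finset.range n).image (Nat.nth fun i => r i ω ≠ ⊤) := by
    intro i hi
    have hi' : r i ω ≤ (cycleStart X r n ω : WithTop ℝ) := hi
    have hne : r i ω ≠ ⊤ := (hi'.trans_lt (WithTop.coe_lt_top _)).ne
    have hgi := WithTop.coe_le_coe.1 ((hge i).trans hi')
    obtain ⟨m, hm⟩ : i ∈ Set.range (Nat.nth fun i => r i ω ≠ ⊤) := Nat.subset_range_nth hne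
    rw [Finset.coe_image]
    refine ⟨m, ?_, hm⟩
    rw [Finset.coe_range, Set.mem_Iio]
    cases n with
    | zero =>
      have h0 : 0 < genTime X 0 ω := by simpa [genTime] using hXpos 0
      have h1 : genTime X 0 ω ≤ genTime X i ω := hmono.monotone i.zero_le
      simp only [cycleStart] at hgi
      linarith
    | succ n =>
      have h1 : i ≤ Nat.nth (fun i => r i ω ≠ ⊤) n := hmono.le_iff_le.1 hgi
      rw [← hm] at h1
      exact Nat.lt_succ_of_le ((Nat.nth_le_nth hinf).1 h1)
  calc numTx r (cycleStart X r n ω) ω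
      ≤ (((Finset.range n).image (Nat.nth fun i => r i ω ≠ ⊤) : Finset ℕ) : Set ℕ).ncard :=
        Set.ncard_le_ncard hsub (Finset.finite_toSet _)
    _ ≤ n := by
        rw [Set.ncard_coe_finset]
        exact Finset.card_image_le.trans (by simp)

theorem accCost_cycleStart_le {κ : ℝ} (hκ : 0 ≤ κ) (hX0 : ∀ i ω, 0 ≤ X i ω)
    (hXpos : ∀ i, 0 < X i ω) (hge : ∀ i, (genTime X i ω : WithTop ℝ) ≤ r i ω)
    (hNB : ∀ i, r i ω = (genTime X i ω : WithTop ℝ) ∨ r i ω = ⊤)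
    (hinf : {i : ℕ | r i ω ≠ ⊤}.Infinite) (n : ℕ) :
    accCost κ X r (cycleStart X r n ω) ω ≤
      κ * n + (∑ k ∈ Finset.range n, cycleLength X r k ω ^ 2) / 2 := by
  rw [Finset.sum_div]
  exact add_le_add (mul_le_mul_of_nonneg_left
    (Nat.cast_le.2 (numTx_cycleStart_le hXpos hge hinf n)) hκ)
    (integral_age_cycle_le hX0 hge hNB hinf n)

end CyclePath

section Stationary

variable {Ω : Type*} {𝓡 : MeasurableSpace Ω} [mΩ : MeasurableSpace Ω] {h𝓡 : 𝓡 ≤ mΩ}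
  {μ : Measure Ω} {X : ℕ → Ω → ℝ} {hX : ∀ i, Measurable (X i)}
  {r : ℕ → Ω → WithTop ℝ} {q ρ c : ℝ}

theorem integral_cycleLength_pos (hq : 0 < q) (hX0 : ∀ i ω, 0 ≤ X i ω)
    (hX_law : ∀ i, μ.map (X i) = expMeasure q) (hr : IsStationaryNB 𝓡 h𝓡 μ X hX r) :
    0 < ∫ ω, cycleLength X r 0 ω ∂μ := by
  have h : ∫ x, x ∂(μ.map (X 0)) = ∫ ω, X 0 ω ∂μ :=
    integral_map (hX 0).aemeasurable (by fun_prop)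
  rw [hX_law, integral_id_expMeasure hq] at h
  calc 0 < 1 / q := by positivity
    _ = ∫ ω, X 0 ω ∂μ := h
    _ ≤ _ := integral_mono_of_nonneg (ae_of_all _ (hX0 0)) hr.integrable
      (ae_of_all _ (cycleLength_zero_ge hX0))

/-- Renewal-reward bound for the long-run cost. -/
theorem ae_eventually_totalCost_lt [IsProbabilityMeasure μ] (hq : 0 < q) (hρc : 0 ≤ ρ * c)
    (hX0 : ∀ i ω, 0 ≤ X i ω)
    (hX_indep : iIndepFun X μ) (hX_law : ∀ i, μ.map (X i) = expMeasure q)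
    (hr : IsStationaryNB 𝓡 h𝓡 μ X hX r) (hT : MemLp (cycleLength X r 0) 2 μ) :
    ∀ᵐ ω ∂μ, ∀ b, (ρ * c + (∫ ω, cycleLength X r 0 ω ^ 2 ∂μ) / 2) /
        (∫ ω, cycleLength X r 0 ω ∂μ) < b → ∀ᶠ t in atTop, totalCost ρ c X r t ω < b := by
  have hET := integral_cycleLength_pos hq hX0 hX_law hr
  have hpos : ∀ᵐ ω ∂μ, ∀ i, 0 < X i ω := by
    rw [ae_all_iff]
    intro i
    have h := ae_pos_expMeasure hq
    rw [← hX_law i] at h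
    exact ae_of_ae_map (hX i).aemeasurable h
  have h1 := strong_law_ae_real (fun n => cycleLength X r n) hr.integrable
    (fun i j hij => hr.indep.indepFun hij) hr.identDistrib
  have h2 := strong_law_ae_real (fun n ω => cycleLength X r n ω ^ 2) hT.integrable_sq
    (fun i j hij => (hr.indep.indepFun hij).comp (measurable_id.pow_const 2)
      (measurable_id.pow_const 2)) fun n => (hr.identDistrib n).comp (measurable_id.pow_const 2)
  filter_upwards [hpos, h1, h2, hr.cycles_finite,
    ae_tendsto_genTime_div hq hX hX_indep hX_law] with ω hXpos hT1 hT2 hinf hgen b hb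
  have htop := tendsto_genTime_atTop hq hgen
  have hge := fun i => hr.causal.1 i ω
  have hNB := fun i => hr.nonBuffering i ω
  simp only [sum_cycleLength] at hT1
  set S : ℕ → ℝ := fun n => cycleStart X r n ω with hS
  set V : ℕ → ℝ := fun n => ∑ k ∈ Finset.range n, cycleLength X r k ω ^ 2 with hV
  have hS1 : Tendsto (fun n => S (n + 1)) atTop atTop :=
    htop.comp (Nat.nth_strictMono hinf).tendsto_atTop
  have hratio : Tendsto (fun n : ℕ => ((n + 1 : ℕ) : ℝ) / ((n + 2 : ℕ) : ℝ)) atTop (𝓝 1) := by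
    have h : Tendsto (fun n : ℕ => 1 - 1 / (((n + 1 : ℕ) : ℝ) + 1)) atTop (𝓝 (1 - 0)) :=
      tendsto_const_nhds.sub
        ((tendsto_add_atTop_iff_nat 1).2 (tendsto_one_div_add_atTop_nhds_zero_nat (𝕜 := ℝ)))
    rw [sub_zero] at h
    refine h.congr fun n => ?_
    push_cast
    field_simp
    ring
  -- For S (n+1) ≤ t < S (n+2) the cost is bounded at the right end and t at the left end. The index
  -- starts at 1 because S 0 = 0 cannot be a denominator.
  have hg : Tendsto (fun n : ℕ => (ρ * c * ((n + 2 : ℕ) : ℝ) + V (n + 2) / 2) / S (n + 1)) atTop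
      (𝓝 ((ρ * c + (∫ ω, cycleLength X r 0 ω ^ 2 ∂μ) / 2) /
        (∫ ω, cycleLength X r 0 ω ∂μ))) := by
    have hnum : Tendsto (fun n : ℕ => ρ * c + V (n + 2) / ((n + 2 : ℕ) : ℝ) / 2) atTop
        (𝓝 (ρ * c + (∫ ω, cycleLength X r 0 ω ^ 2 ∂μ) / 2)) :=
      tendsto_const_nhds.add (((tendsto_add_atTop_iff_nat 2).2 hT2).div_const 2)
    have hden : Tendsto (fun n : ℕ => S (n + 1) / ((n + 1 : ℕ) : ℝ)) atTop
        (𝓝 (∫ ω, cycleLength X r 0 ω ∂μ)) := (tendsto_add_atTop_iff_nat 1).2 hT1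
    have hden' := hden.mul hratio
    rw [mul_one] at hden'
    refine (hnum.div hden' hET.ne').congr fun n => ?_
    have e1 : ((n + 1 : ℕ) : ℝ) ≠ 0 := by positivity
    have e2 : ((n + 2 : ℕ) : ℝ) ≠ 0 := by positivity
    simp only [Pi.div_apply]
    rw [div_mul_div_cancel₀ e1]
    rcases eq_or_ne (S (n + 1)) 0 with h0 | h0
    · simp [h0]
    · field_simp
  refine eventually_lt_of_interpolation hS1 hg hb fun n t ht0 ht1 ht2 => ?_
  have hacc : accCost (ρ * c) X r t ω ≤ ρ * c * ((n + 2 : ℕ) : ℝ) + V (n + 2) / 2 :=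
    (accCost_mono hρc hge htop ht0.le ht2.le).trans
      (accCost_cycleStart_le hρc hX0 hXpos hge hNB hinf (n + 2))
  have hSpos : 0 < S (n + 1) := by
    have h0 : genTime X 0 ω ≤ S (n + 1) := genTime_mono hX0 ω (Nat.zero_le _)
    have h00 : 0 < genTime X 0 ω := by simpa [genTime] using hXpos 0
    linarith
  rw [totalCost_eq]
  exact div_le_div₀ ((accCost_nonneg hρc hge ht0.le).trans hacc) hacc hSpos ht1

/-- Substituting Var T = E T² − (E T)² turns the cycle cost into the renewal-reward quotient. -/
theorem cycleCost_eq_ofReal [IsProbabilityMeasure μ] (hρc : 0 ≤ ρ * c)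
    (hT : MemLp (cycleLength X r 0) 2 μ)
    (hET : 0 < ∫ ω, cycleLength X r 0 ω ∂μ) :
    cycleCost μ ρ c X r = ENNReal.ofReal ((ρ * c + (∫ ω, cycleLength X r 0 ω ^ 2 ∂μ) / 2) /
      (∫ ω, cycleLength X r 0 ω ∂μ)) := by
  have hvar := variance_eq_sub hT
  have hvar0 := variance_nonneg (cycleLength X r 0) μ
  unfold cycleCost
  rw [← hT.ofReal_variance_eq, ← ENNReal.ofReal_add hvar0 (by linarith),
    ← ENNReal.ofReal_div_of_pos (by linarith), ← ENNReal.ofReal_add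
      (div_nonneg (by linarith) (by linarith)) (by linarith), hvar]
  congr 1
  simp only [Pi.pow_apply]
  field_simp
  ring

/-- The long-run cost bounds the cycle cost of every stationary policy from below. -/
theorem ofReal_le_cycleCost [IsProbabilityMeasure μ] {β θ : ℝ} (hq : 0 < q) (hθ : 0 ≤ θ)
    (hβ : β = θ + 1 / q) (hκ : ρ * c = β * θ - θ ^ 2 / 2)
    (hX0 : ∀ i ω, 0 ≤ X i ω) (hX_indep : iIndepFun X μ)
    (hX_law : ∀ i, μ.map (X i) = expMeasure q)
    (h𝓡_indep : Indep 𝓡 (⨆ i, MeasurableSpace.comap (X i) inferInstance) μ)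
    (hr : IsStationaryNB 𝓡 h𝓡 μ X hX r) : ENNReal.ofReal β ≤ cycleCost μ ρ c X r := by
  have hq' : 0 < 1 / q := by positivity
  have hκ0 : 0 ≤ ρ * c := by
    rw [hκ, ← ageValue_of_ge (β := β) le_rfl]
    exact ageValue_nonneg hθ (by linarith) hθ
  have hET := integral_cycleLength_pos hq hX0 hX_law hr
  by_cases hT : MemLp (cycleLength X r 0) 2 μ
  · rw [cycleCost_eq_ofReal hκ0 hT hET]
    refine ENNReal.ofReal_le_ofReal (le_of_forall_gt fun b hb => ?_)
    obtain ⟨b', hb1, hb2⟩ := exists_between hb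
    -- A single sample path satisfying both almost sure bounds suffices to compare the two
    -- constants.
    obtain ⟨ω, hω1, hω2⟩ := ((ae_le_liminf_totalCost hq hθ hβ hκ hX0 hX_indep hX_law h𝓡_indep
      hr.causal).and (ae_eventually_totalCost_lt hq hκ0 hX0 hX_indep hX_law hr hT)).exists
    have h1 : liminf (fun t : ℝ => ((totalCost ρ c X r t ω : ℝ) : EReal)) atTop ≤ (b' : EReal) :=
      liminf_le_of_frequently_le'
        ((hω2 b' hb1).mono fun t ht => EReal.coe_le_coe_iff.2 ht.le).frequently
    exact (EReal.coe_le_coe_iff.1 (hω1.trans h1)).trans_lt hb2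
  · have hev := evariance_eq_top hr.integrable.aestronglyMeasurable hT
    have htop : cycleCost μ ρ c X r = ⊤ := by
      unfold cycleCost
      rw [hev, top_add, ENNReal.top_div_of_ne_top ENNReal.ofReal_ne_top, top_add]
    rw [htop]
    exact le_top

end Stationary

/-! ### The threshold policy -/

section ThresholdCausal

variable {Ω : Type*} {X : ℕ → Ω → ℝ} {θ : ℝ}

theorem thresholdPolicy_ne_top_iff {i : ℕ} {ω : Ω} :
    thresholdPolicy X θ i ω ≠ ⊤ ↔ θ < genTime X i ω - thresholdStart X θ i ω := by
  unfold thresholdPolicy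
  split_ifs with h <;> simp [h]

theorem genTime_le_thresholdPolicy (i : ℕ) (ω : Ω) :
    (genTime X i ω : WithTop ℝ) ≤ thresholdPolicy X θ i ω := by
  unfold thresholdPolicy
  split_ifs
  · exact le_rfl
  · exact le_top

theorem isNonBuffering_thresholdPolicy : IsNonBuffering X (thresholdPolicy X θ) := by
  intro i ω
  unfold thresholdPolicy
  split_ifs
  · exact Or.inl rfl
  · exact Or.inr rfl

/-- The decision on packet i uses only generation times up to t_i. On {t_i ≤ t} these equal their
minimum with t, which is known at time t. -/
theorem isCausal_thresholdPolicy {𝓡 : MeasurableSpace Ω} [mΩ : MeasurableSpace Ω] {h𝓡 : 𝓡 ≤ mΩ}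
    {hX : ∀ i, Measurable (X i)} (hX0 : ∀ i ω, 0 ≤ X i ω) :
    IsCausal 𝓡 h𝓡 X hX (thresholdPolicy X θ) := by
  refine ⟨genTime_le_thresholdPolicy, fun i t => ?_⟩
  have hgen : ∀ i (u : ℝ), u ≤ t →
      MeasurableSet[infoFiltration 𝓡 h𝓡 X hX t] {ω | genTime X i ω ≤ u} :=
    fun i u hu => (le_sup_right : _ ≤ infoFiltration 𝓡 h𝓡 X hX t) _
      (MeasurableSpace.measurableSet_generateFrom ⟨i, u, hu, rfl⟩)
  have hmin : ∀ i, Measurable[infoFiltration 𝓡 h𝓡 X hX t] fun ω => min (genTime X i ω) t := by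
    intro i
    refine measurable_of_Iic fun u => ?_
    by_cases hu : t ≤ u
    · have : (fun ω => min (genTime X i ω) t) ⁻¹' Set.Iic u = Set.univ :=
        Set.eq_univ_of_forall fun ω => (min_le_right _ _).trans hu
      rw [this]
      exact MeasurableSet.univ
    · have : (fun ω => min (genTime X i ω) t) ⁻¹' Set.Iic u = {ω | genTime X i ω ≤ u} := by
        ext ω
        simp [hu]
      rw [this]
      exact hgen i u (not_le.1 hu).le
  have hstart : ∀ i, ∃ h : Ω → ℝ, Measurable[infoFiltration 𝓡 h𝓡 X hX t] h ∧
      ∀ ω, genTime X i ω ≤ t → thresholdStart X θ i ω = h ω := by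
    intro i
    induction i with
    | zero => exact ⟨fun _ => 0, measurable_const, fun _ _ => rfl⟩
    | succ i ih =>
      obtain ⟨h, hm, hh⟩ := ih
      refine ⟨fun ω => if θ < min (genTime X i ω) t - h ω then min (genTime X i ω) t else h ω,
        Measurable.ite (measurableSet_lt measurable_const ((hmin i).sub hm)) (hmin i) hm,
        fun ω hω => ?_⟩
      have hi : genTime X i ω ≤ t := le_trans (genTime_mono hX0 ω i.le_succ) hω
      simp only [thresholdStart, hh ω hi, min_eq_left hi]
  obtain ⟨h, hm, hh⟩ := hstart i
  have hset : {ω | thresholdPolicy X θ i ω ≤ (t : WithTop ℝ)} =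
      {ω | genTime X i ω ≤ t} ∩ {ω | θ < min (genTime X i ω) t - h ω} := by
    ext ω
    simp only [Set.mem_ofPred_eq, Set.mem_inter_iff]
    constructor
    · intro hω
      have hi := WithTop.coe_le_coe.1 ((genTime_le_thresholdPolicy i ω).trans hω)
      have h1 := thresholdPolicy_ne_top_iff.1 (hω.trans_lt (WithTop.coe_lt_top t)).ne
      rw [hh ω hi] at h1
      exact ⟨hi, by rwa [min_eq_left hi]⟩
    · rintro ⟨hi, h1⟩
      rw [min_eq_left hi, ← hh ω hi] at h1
      unfold thresholdPolicy
      rw [if_pos h1]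
      exact WithTop.coe_le_coe.2 hi
  rw [hset]
  exact (hgen i t le_rfl).inter (measurableSet_lt measurable_const ((hmin i).sub hm))

/-- After a last transmission the cycle start would be frozen while the generation times tend to
infinity, so the threshold would be exceeded again. -/
theorem infinite_transmitted_thresholdPolicy {ω : Ω}
    (htop : Tendsto (fun i => genTime X i ω) atTop atTop) :
    {i : ℕ | thresholdPolicy X θ i ω ≠ ⊤}.Infinite := by
  refine Set.infinite_of_forall_exists_gt fun N => ?_
  by_contra hcon
  push Not at hcon
  have hno : ∀ i, N < i → ¬ θ < genTime X i ω - thresholdStart X θ i ω := fun i hi h =>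
    absurd (hcon i (thresholdPolicy_ne_top_iff.2 h)) (not_le.2 hi)
  have hconst : ∀ k, thresholdStart X θ (N + 1 + k) ω = thresholdStart X θ (N + 1) ω := by
    intro k
    induction k with
    | zero => rfl
    | succ k ih =>
      rw [← ih, ← add_assoc]
      exact if_neg (hno _ (by omega))
  obtain ⟨i, hi1, hi2⟩ := ((htop.eventually_gt_atTop
    (thresholdStart X θ (N + 1) ω + θ)).and (eventually_ge_atTop (N + 1))).exists
  obtain ⟨k, rfl⟩ := Nat.exists_eq_add_of_le hi2
  have := hno (N + 1 + k) (by omega)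
  rw [hconst] at this
  exact this (by linarith)

end ThresholdCausal

/-! ### Cycles as functions of the sequence of interarrival times -/

section Sequences

/-- The coordinates of a sequence of interarrival times. -/
def coord (i : ℕ) (x : ℕ → ℝ) : ℝ := x i

/-- The index of the first packet transmitted by the threshold policy. -/
noncomputable def firstTx (θ : ℝ) (x : ℕ → ℝ) : ℕ := sInf {m | θ < genTime coord m x}

/-- The length of the first cycle of the threshold policy. -/
noncomputable def firstCycle (θ : ℝ) (x : ℕ → ℝ) : ℝ := genTime coord (firstTx θ x) x

/-- The interarrival times after the first `n` packets. -/
def tail (n : ℕ) (x : ℕ → ℝ) (i : ℕ) : ℝ := x (n + i)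

/-- The interarrival times after the first cycle. -/
noncomputable def nextCycle (θ : ℝ) (x : ℕ → ℝ) : ℕ → ℝ := tail (firstTx θ x + 1) x

variable {θ : ℝ} {x : ℕ → ℝ}

theorem genTime_tail (m i : ℕ) (x : ℕ → ℝ) :
    genTime coord (m + 1 + i) x = genTime coord m x + genTime coord i (tail (m + 1) x) := by
  unfold genTime
  rw [show m + 1 + i + 1 = m + 1 + (i + 1) by ring, Finset.sum_range_add]
  rfl

theorem firstTx_spec (htop : Tendsto (fun i => genTime coord i x) atTop atTop) :
    θ < genTime coord (firstTx θ x) x ∧ ∀ k < firstTx θ x, genTime coord k x ≤ θ :=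
  ⟨Nat.sInf_mem (s := {m | θ < genTime coord m x}) (htop.eventually_gt_atTop θ).exists,
    fun _ hk => not_lt.1 (Nat.notMem_of_lt_sInf hk)⟩

theorem tendsto_genTime_nextCycle (htop : Tendsto (fun i => genTime coord i x) atTop atTop) :
    Tendsto (fun i => genTime coord i (nextCycle θ x)) atTop atTop := by
  have h : ∀ i, genTime coord i (nextCycle θ x) =
      genTime coord (i + (firstTx θ x + 1)) x + -genTime coord (firstTx θ x) x := by
    intro i
    have := genTime_tail (firstTx θ x) i x
    rw [add_comm i, this, nextCycle]; ring
  simp_rw [h]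
  exact tendsto_atTop_add_const_right _ _ ((tendsto_add_atTop_iff_nat _).2 htop)

theorem thresholdStart_eq_zero (htop : Tendsto (fun i => genTime coord i x) atTop atTop) {k : ℕ}
    (hk : k ≤ firstTx θ x) : thresholdStart coord θ k x = 0 := by
  induction k with
  | zero => rfl
  | succ k ih =>
    rw [thresholdStart, ih (by omega), if_neg]
    rw [sub_zero, not_lt]
    exact (firstTx_spec htop).2 k (by omega)

/-- Regeneration: after the first transmission the rule acts on the shifted sequence as it did on
the original, with the time origin moved. -/
theorem thresholdStart_nextCycle (htop : Tendsto (fun i => genTime coord i x) atTop atTop)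
    (i : ℕ) : thresholdStart coord θ (firstTx θ x + 1 + i) x =
      genTime coord (firstTx θ x) x + thresholdStart coord θ i (nextCycle θ x) := by
  induction i with
  | zero =>
    have h0 : thresholdStart coord θ 0 (nextCycle θ x) = 0 := rfl
    rw [add_zero, h0, add_zero, thresholdStart, thresholdStart_eq_zero htop le_rfl, sub_zero,
      if_pos (firstTx_spec htop).1]
  | succ i ih =>
    rw [← add_assoc, thresholdStart, ih, genTime_tail, thresholdStart]
    change (if θ < _ + genTime coord i (nextCycle θ x) - _ then _ else _) = _
    rw [add_sub_add_left_eq_sub]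
    split_ifs
    · rfl
    · rfl

theorem thresholdPolicy_nextCycle (htop : Tendsto (fun i => genTime coord i x) atTop atTop)
    (i : ℕ) : thresholdPolicy coord θ (firstTx θ x + 1 + i) x ≠ ⊤ ↔
      thresholdPolicy coord θ i (nextCycle θ x) ≠ ⊤ := by
  rw [thresholdPolicy_ne_top_iff, thresholdPolicy_ne_top_iff, thresholdStart_nextCycle htop,
    genTime_tail, add_sub_add_left_eq_sub]
  rfl

theorem eq_nth_of_strictMono {p : ℕ → Prop} (hp : {k | p k}.Infinite) {f : ℕ → ℕ}
    (hf : StrictMono f) (hmaps : ∀ n, p (f n)) (hsurj : ∀ k, p k → ∃ n, f n = k) (n : ℕ) :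
    f n = Nat.nth p n :=
  Nat.eq_nth_of_strictMonoOn_of_mapsTo_of_surjOn f
    (fun k hk => (hsurj k hk).imp fun _ h => ⟨fun hfin => absurd hfin hp, h⟩)
    (fun n _ => hmaps n) (hf.strictMonoOn _) (fun hfin => absurd hfin hp)

theorem nth_thresholdPolicy (htop : Tendsto (fun i => genTime coord i x) atTop atTop) (n : ℕ) :
    Nat.nth (fun i => thresholdPolicy coord θ i x ≠ ⊤) n =
      match n with
      | 0 => firstTx θ x
      | n + 1 => firstTx θ x + 1 +
          Nat.nth (fun i => thresholdPolicy coord θ i (nextCycle θ x) ≠ ⊤) n := by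
  have hinf := infinite_transmitted_thresholdPolicy (θ := θ) htop
  have hinf' := infinite_transmitted_thresholdPolicy (θ := θ)
    (tendsto_genTime_nextCycle (θ := θ) htop)
  let f : ℕ → ℕ := fun n => match n with
    | 0 => firstTx θ x
    | n + 1 => firstTx θ x + 1 +
        Nat.nth (fun i => thresholdPolicy coord θ i (nextCycle θ x) ≠ ⊤) n
  refine (eq_nth_of_strictMono hinf (f := f) ?_ ?_ ?_ n).symm
  · refine strictMono_nat_of_lt_succ fun n => ?_
    cases n with
    | zero => simp only [f]; omega
    | succ n =>
      have := Nat.nth_strictMono hinf' (Nat.lt_add_one n)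
      simp only [f]; omega
  · intro n
    cases n with
    | zero =>
      refine thresholdPolicy_ne_top_iff.2 ?_
      simp only [f]
      rw [thresholdStart_eq_zero htop le_rfl, sub_zero]
      exact (firstTx_spec htop).1
    | succ n => exact (thresholdPolicy_nextCycle htop _).2 (Nat.nth_mem_of_infinite hinf' n)
  · intro k hk
    rcases lt_trichotomy k (firstTx θ x) with h | h | h
    · have h1 := thresholdPolicy_ne_top_iff.1 hk
      rw [thresholdStart_eq_zero htop h.le, sub_zero] at h1
      exact absurd ((firstTx_spec htop).2 k h) (not_le.2 h1)
    · exact ⟨0, h.symm⟩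
    · obtain ⟨i, rfl⟩ := Nat.exists_eq_add_of_le (Nat.succ_le_of_lt h)
      have hi : i ∈ {i | thresholdPolicy coord θ i (nextCycle θ x) ≠ ⊤} :=
        (thresholdPolicy_nextCycle htop i).1 hk
      obtain ⟨n, hn⟩ := Nat.subset_range_nth hi
      exact ⟨n + 1, by simp only [f]; rw [hn]⟩

theorem cycleLength_nextCycle (htop : Tendsto (fun i => genTime coord i x) atTop atTop) (n : ℕ) :
    cycleLength coord (thresholdPolicy coord θ) (n + 1) x =
      cycleLength coord (thresholdPolicy coord θ) n (nextCycle θ x) := by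
  have hstart : ∀ n, cycleStart coord (thresholdPolicy coord θ) (n + 1) x =
      genTime coord (firstTx θ x) x +
        cycleStart coord (thresholdPolicy coord θ) n (nextCycle θ x) := by
    intro n
    cases n with
    | zero =>
      simp only [cycleStart, add_zero]
      rw [nth_thresholdPolicy htop]
    | succ n =>
      simp only [cycleStart]
      rw [nth_thresholdPolicy htop, genTime_tail]
      rfl
  simp only [cycleLength, hstart]
  ring

/-- Reduces the joint law of all cycles to one step: the first cycle and the sequence that follows
it. -/
theorem cycleLength_eq_iterate (htop : Tendsto (fun i => genTime coord i x) atTop atTop) (n : ℕ) :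
    cycleLength coord (thresholdPolicy coord θ) n x = firstCycle θ ((nextCycle θ)^[n] x) := by
  induction n generalizing x with
  | zero =>
    simp only [cycleLength, cycleStart, sub_zero, Function.iterate_zero, id]
    rw [nth_thresholdPolicy htop]
    rfl
  | succ n ih =>
    rw [cycleLength_nextCycle htop, ih (tendsto_genTime_nextCycle htop),
      Function.iterate_succ_apply]

theorem measurable_genTime_coord (m : ℕ) : Measurable (genTime coord m) :=
  measurable_genTime (fun i => measurable_pi_apply i) m

theorem measurable_firstTx : Measurable (firstTx θ) := by
  have hS : ∀ m, MeasurableSet {x : ℕ → ℝ | θ < genTime coord m x} := fun m =>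
    measurableSet_lt measurable_const (measurable_genTime_coord m)
  refine measurable_of_Iic fun m => ?_
  -- The second piece accounts for the infimum of the empty set being 0.
  have h : firstTx θ ⁻¹' Set.Iic m = (⋃ k ∈ Set.Iic m, {x | θ < genTime coord k x}) ∪
      ⋂ k, {x | θ < genTime coord k x}ᶜ := by
    ext x
    simp only [Set.mem_preimage, Set.mem_Iic, Set.mem_union, Set.mem_iUnion, Set.mem_ofPred_eq,
      Set.mem_iInter, Set.mem_compl_iff, exists_prop]
    by_cases hne : {m | θ < genTime coord m x}.Nonempty
    · constructor
      · intro hm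
        exact Or.inl ⟨_, hm, Nat.sInf_mem hne⟩
      · rintro (⟨k, hk, hk'⟩ | hall)
        · exact (Nat.sInf_le hk').trans hk
        · exact absurd hne.choose_spec (hall _)
    · have hemp : ∀ k, ¬ θ < genTime coord k x := fun k hk => hne ⟨k, hk⟩
      have h0 : firstTx θ x = 0 := by
        unfold firstTx; rw [Set.not_nonempty_iff_eq_empty.1 hne, Nat.sInf_empty]
      simp [h0, hemp]
  rw [h]
  exact (MeasurableSet.biUnion (Set.to_countable _) fun k _ => hS k).union
    (MeasurableSet.iInter fun k => (hS k).compl)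

theorem measurable_firstCycle : Measurable (firstCycle θ) := by
  have h : Measurable fun p : ℕ × (ℕ → ℝ) => genTime coord p.1 p.2 :=
    measurable_from_prod_countable_right fun m => measurable_genTime_coord m
  exact h.comp (measurable_firstTx.prodMk measurable_id)

theorem measurable_tail (n : ℕ) : Measurable (tail n) :=
  measurable_pi_iff.2 fun i => measurable_pi_apply (n + i)

theorem measurable_nextCycle : Measurable (nextCycle θ) := by
  have h : Measurable fun p : ℕ × (ℕ → ℝ) => tail (p.1 + 1) p.2 :=
    measurable_from_prod_countable_right fun m => measurable_tail (m + 1)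
  exact h.comp (measurable_firstTx.prodMk measurable_id)

end Sequences

/-! ### Independence and distribution of the cycles of the threshold policy -/

section CycleLaw

/-- Fubini, integrating out `L` with the data in `m` fixed. Membership in `C` is encoded by a real
indicator, so that (1_C, σ) is one random variable independent of `L`. -/
theorem measure_inter_add_mem_of_indep {Ω : Type*} {m : MeasurableSpace Ω}
    [mΩ : MeasurableSpace Ω] {μ : Measure Ω} [IsProbabilityMeasure μ] (hm : m ≤ mΩ) {C : Set Ω}
    (hC : MeasurableSet[m] C) {σ : Ω → ℝ} (hσ : Measurable[m] σ) {L : Ω → ℝ} (hL : Measurable L)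
    (hind : Indep m (MeasurableSpace.comap L inferInstance) μ) {D : Set ℝ}
    (hD : MeasurableSet D) :
    μ (C ∩ {ω | σ ω + L ω ∈ D}) =
      ∫⁻ ω, C.indicator (fun ω => μ.map L {l | σ ω + l ∈ D}) ω ∂μ := by
  have hV : Measurable[m] fun ω => (C.indicator (fun _ => (1 : ℝ)) ω, σ ω) :=
    (measurable_const.indicator hC).prodMk hσ
  have hV' : Measurable fun ω => (C.indicator (fun _ => (1 : ℝ)) ω, σ ω) := hV.mono hm le_rfl
  have hindf : IndepFun (fun ω => (C.indicator (fun _ => (1 : ℝ)) ω, σ ω)) L μ :=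
    indep_of_indep_of_le_left hind hV.comap_le
  have hprod := (indepFun_iff_map_prod_eq_prod_map_map hV'.aemeasurable hL.aemeasurable).1 hindf
  have := Measure.isProbabilityMeasure_map (μ := μ) hL.aemeasurable
  let S : Set ((ℝ × ℝ) × ℝ) := {p | p.1.1 = 1 ∧ p.1.2 + p.2 ∈ D}
  have hS : MeasurableSet S := by
    refine MeasurableSet.inter (measurableSet_eq_fun (by fun_prop) (by fun_prop)) ?_
    have hadd : Measurable fun p : (ℝ × ℝ) × ℝ => p.1.2 + p.2 := by fun_prop
    exact hadd hD
  have hpre : C ∩ {ω | σ ω + L ω ∈ D} =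
      (fun ω => ((C.indicator (fun _ => (1 : ℝ)) ω, σ ω), L ω)) ⁻¹' S := by
    ext ω
    by_cases h : ω ∈ C <;> simp [S, h]
  rw [hpre, ← Measure.map_apply (hV'.prodMk hL) hS, hprod, Measure.prod_apply hS,
    lintegral_map (measurable_measure_prodMk_left hS) hV']
  refine lintegral_congr fun ω => ?_
  by_cases h : ω ∈ C
  · have h1 : C.indicator (fun _ => (1 : ℝ)) ω = 1 := Set.indicator_of_mem h _
    rw [h1, Set.indicator_of_mem h]
    congr 1
    ext l
    simp [S]
  · have h0 : C.indicator (fun _ => (1 : ℝ)) ω = 0 := Set.indicator_of_notMem h _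
    have hemp : Prod.mk (0, σ ω) ⁻¹' S = ∅ := by
      ext l
      simp [S]
    rw [h0, Set.indicator_of_notMem h, hemp, measure_empty]

/-- The distribution of the cycle length of the threshold policy: a deterministic time `θ` followed
by an exponential waiting time. -/
noncomputable def cycleLaw (q θ : ℝ) : Measure ℝ := (expMeasure q).map fun y => θ + y

/-- The distribution of a sequence of independent exponential interarrival times. -/
noncomputable def seqMeasure (q : ℝ) : Measure (ℕ → ℝ) :=
  Measure.infinitePi fun _ => expMeasure q

variable {q θ : ℝ}

theorem isProbabilityMeasure_cycleLaw (hq : 0 < q) : IsProbabilityMeasure (cycleLaw q θ) := by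
  have := isProbabilityMeasure_expMeasure hq
  exact Measure.isProbabilityMeasure_map (by fun_prop)

theorem isProbabilityMeasure_seqMeasure (hq : 0 < q) : IsProbabilityMeasure (seqMeasure q) := by
  have := isProbabilityMeasure_expMeasure hq
  unfold seqMeasure
  infer_instance

theorem measurable_coord (i : ℕ) : Measurable (coord i) := measurable_pi_apply i

theorem map_coord_seqMeasure (hq : 0 < q) (i : ℕ) :
    (seqMeasure q).map (coord i) = expMeasure q := by
  have := isProbabilityMeasure_expMeasure hq
  exact Measure.infinitePi_map_eval (fun _ => expMeasure q) i

theorem iIndepFun_coord (hq : 0 < q) : iIndepFun coord (seqMeasure q) := by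
  have := isProbabilityMeasure_expMeasure hq
  exact iIndepFun_infinitePi (P := fun _ : ℕ => expMeasure q) (X := fun _ x => x)
    fun _ => measurable_id

theorem map_tail_seqMeasure (hq : 0 < q) (n : ℕ) :
    (seqMeasure q).map (tail n) = seqMeasure q := by
  have h := (iIndepFun_coord hq).precomp (g := fun i => n + i) (add_right_injective n)
  have h1 := h.map_fun_eq_infinitePi_map fun i => measurable_coord (n + i)
  simp only [map_coord_seqMeasure hq] at h1
  exact h1

/-- Memorylessness: from any level s ≤ θ, given that θ is exceeded, the overshoot is exponential and
does not depend on s. -/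
theorem expMeasure_add_mem_inter_Ioi (hq : 0 < q) {s : ℝ} (hs : s ≤ θ) {B : Set ℝ}
    (hB : MeasurableSet B) : expMeasure q {l | s + l ∈ B ∩ Set.Ioi θ} =
      expMeasure q {l | s + l ∈ Set.Ioi θ} * cycleLaw q θ B := by
  have hθm : Measurable fun y : ℝ => θ + y := by fun_prop
  have hsm : Measurable fun y : ℝ => y - (θ - s) := by fun_prop
  have h := congrArg (fun ν => ν ((fun y => θ + y) ⁻¹' B))
    (expMeasure_restrict_Ioi_map_sub hq (sub_nonneg.2 hs))
  rw [Measure.map_apply hsm (hθm hB), Measure.restrict_apply (hsm (hθm hB)),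
    Measure.smul_apply, smul_eq_mul] at h
  have e1 : {l | s + l ∈ B ∩ Set.Ioi θ} =
      (fun y => y - (θ - s)) ⁻¹' ((fun y => θ + y) ⁻¹' B) ∩ Set.Ioi (θ - s) := by
    ext l
    simp only [Set.mem_ofPred_eq, Set.mem_inter_iff, Set.mem_preimage, Set.mem_Ioi]
    rw [show θ + (l - (θ - s)) = s + l by ring, sub_lt_iff_lt_add']
  have e2 : {l | s + l ∈ Set.Ioi θ} = Set.Ioi (θ - s) := by
    ext l
    simp only [Set.mem_ofPred_eq, Set.mem_Ioi]
    rw [sub_lt_iff_lt_add']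
  rw [e1, h, e2, expMeasure_Ioi hq, max_eq_left (sub_nonneg.2 hs), cycleLaw,
    Measure.map_apply hθm hB]

/-- The first cycle ends with the generation of packet `m`, and its length belongs to `B`. -/
def cycleEvent (θ : ℝ) (m : ℕ) (B : Set ℝ) : Set (ℕ → ℝ) :=
  {x | ∀ k < m, genTime coord k x ≤ θ} ∩ {x | genTime coord m x ∈ B ∩ Set.Ioi θ}

theorem measurable_genTime_iSup {k : ℕ} {S : Set ℕ} (hS : Set.Iic k ⊆ S) :
    Measurable[⨆ i ∈ S, MeasurableSpace.comap (coord i) inferInstance] (genTime coord k) := by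
  refine Finset.measurable_fun_sum _ fun i hi => ?_
  have hle : MeasurableSpace.comap (coord i) inferInstance ≤
      ⨆ i ∈ S, MeasurableSpace.comap (coord i) inferInstance :=
    le_iSup₂_of_le (f := fun i (_ : i ∈ S) => MeasurableSpace.comap (coord i) inferInstance) i
      (hS (Nat.lt_succ_iff.1 (Finset.mem_range.1 hi))) le_rfl
  exact (comap_measurable (coord i)).mono hle le_rfl

theorem measurableSet_forall_genTime_le {m : ℕ} {S : Set ℕ} (hS : Set.Iio m ⊆ S) :
    MeasurableSet[⨆ i ∈ S, MeasurableSpace.comap (coord i) inferInstance]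
      {x | ∀ k < m, genTime coord k x ≤ θ} := by
  have h : {x : ℕ → ℝ | ∀ k < m, genTime coord k x ≤ θ} =
      ⋂ k ∈ Set.Iio m, genTime coord k ⁻¹' Set.Iic θ := by
    ext x; simp
  rw [h]
  refine MeasurableSet.biInter (Set.to_countable _) fun k hk => ?_
  have hm : Measurable[⨆ i ∈ S, MeasurableSpace.comap (coord i) inferInstance] (genTime coord k) :=
    measurable_genTime_iSup fun i (hi : i ≤ k) => hS (show i < m from lt_of_le_of_lt hi hk)
  exact hm measurableSet_Iic

theorem measurableSet_cycleEvent_iSup (m : ℕ) {B : Set ℝ} (hB : MeasurableSet B) :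
    MeasurableSet[⨆ i ∈ Set.Iic m, MeasurableSpace.comap (coord i) inferInstance]
      (cycleEvent θ m B) := by
  refine MeasurableSet.inter (measurableSet_forall_genTime_le fun k (hk : k < m) => hk.le) ?_
  have hm : Measurable[⨆ i ∈ Set.Iic m, MeasurableSpace.comap (coord i) inferInstance]
    (genTime coord m) := measurable_genTime_iSup subset_rfl
  exact hm (hB.inter measurableSet_Ioi)

theorem iSup_comap_coord_le (S : Set ℕ) :
    ⨆ i ∈ S, MeasurableSpace.comap (coord i) inferInstance ≤
      (inferInstance : MeasurableSpace (ℕ → ℝ)) :=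
  iSup₂_le fun i _ => (measurable_coord i).comap_le

theorem measurableSet_cycleEvent (m : ℕ) {B : Set ℝ} (hB : MeasurableSet B) :
    MeasurableSet (cycleEvent θ m B) :=
  iSup_comap_coord_le _ _ (measurableSet_cycleEvent_iSup m hB)

/-- The event depends on the coordinates up to m and the tail on those beyond m. -/
theorem seqMeasure_cycleEvent_inter_tail (hq : 0 < q) (m : ℕ) {B : Set ℝ} (hB : MeasurableSet B)
    {A : Set (ℕ → ℝ)} (hA : MeasurableSet A) :
    seqMeasure q (cycleEvent θ m B ∩ tail (m + 1) ⁻¹' A) =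
      seqMeasure q (cycleEvent θ m B) * seqMeasure q A := by
  have hind := indep_iSup_of_disjoint (fun i => (measurable_coord i).comap_le)
    (iIndepFun_coord hq) (S := Set.Iic m) (T := Set.Ioi m)
    (Set.disjoint_left.2 fun i (hi : i ≤ m) (hi' : m < i) => absurd hi (not_le.2 hi'))
  have htail : Measurable[⨆ i ∈ Set.Ioi m, MeasurableSpace.comap (coord i) inferInstance]
      (tail (m + 1)) := by
    refine @measurable_pi_lambda _ _ _ (_) _ _ fun i => ?_
    have hle : MeasurableSpace.comap (coord (m + 1 + i)) inferInstance ≤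
        ⨆ i ∈ Set.Ioi m, MeasurableSpace.comap (coord i) inferInstance :=
      le_iSup₂_of_le (f := fun i (_ : i ∈ Set.Ioi m) =>
        MeasurableSpace.comap (coord i) inferInstance) (m + 1 + i)
        (show m < m + 1 + i by omega) le_rfl
    exact (comap_measurable (coord (m + 1 + i))).mono hle le_rfl
  rw [Indep_iff] at hind
  rw [hind _ _ (measurableSet_cycleEvent_iSup m hB) (htail hA),
    ← Measure.map_apply (measurable_tail (m + 1)) hA, map_tail_seqMeasure hq]

/-- The cycle length is independent of the index of the packet ending the cycle: given the
generation times before packet m, all at most θ, the law of the overshoot does not depend on them.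
-/
theorem seqMeasure_cycleEvent (hq : 0 < q) (hθ : 0 ≤ θ) (m : ℕ) {B : Set ℝ}
    (hB : MeasurableSet B) : seqMeasure q (cycleEvent θ m B) =
      seqMeasure q (cycleEvent θ m Set.univ) * cycleLaw q θ B := by
  have := isProbabilityMeasure_seqMeasure hq
  have := isProbabilityMeasure_cycleLaw (θ := θ) hq
  let σ : (ℕ → ℝ) → ℝ := fun x => ∑ i ∈ Finset.range m, coord i x
  let C : Set (ℕ → ℝ) := {x | ∀ k < m, genTime coord k x ≤ θ}
  have hσC : ∀ x ∈ C, σ x ≤ θ := by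
    intro x hx
    cases m with
    | zero => simpa [σ] using hθ
    | succ m => exact hx m m.lt_succ_self
  have hσm : Measurable[⨆ i ∈ Set.Iio m, MeasurableSpace.comap (coord i) inferInstance] σ := by
    cases m with
    | zero => simp only [σ, Finset.range_zero, Finset.sum_empty]; exact measurable_const
    | succ m => exact measurable_genTime_iSup fun i hi => Nat.lt_succ_of_le hi
  have hind : Indep (⨆ i ∈ Set.Iio m, MeasurableSpace.comap (coord i) inferInstance)
      (MeasurableSpace.comap (coord m) inferInstance) (seqMeasure q) := by
    have h := indep_iSup_of_disjoint (fun i => (measurable_coord i).comap_le)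
      (iIndepFun_coord hq) (S := Set.Iio m) (T := {m}) (by simp)
    simpa using h
  have key : ∀ D : Set ℝ, MeasurableSet D → seqMeasure q (cycleEvent θ m D) =
      (∫⁻ x, C.indicator (fun x => expMeasure q {l | σ x + l ∈ Set.Ioi θ}) x ∂seqMeasure q) *
        cycleLaw q θ D := by
    intro D hD
    have hev : cycleEvent θ m D = C ∩ {x | σ x + coord m x ∈ D ∩ Set.Ioi θ} := by
      ext x
      simp only [cycleEvent, C, σ, genTime, Finset.sum_range_succ]
    rw [hev, measure_inter_add_mem_of_indep (iSup_comap_coord_le _)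
      (measurableSet_forall_genTime_le subset_rfl) hσm (measurable_coord m) hind
      (hD.inter measurableSet_Ioi), map_coord_seqMeasure hq,
      ← lintegral_mul_const' _ _ (measure_ne_top _ _)]
    refine lintegral_congr fun x => ?_
    by_cases h : x ∈ C
    · rw [Set.indicator_of_mem h, Set.indicator_of_mem h,
        expMeasure_add_mem_inter_Ioi hq (hσC x h) hD]
    · rw [Set.indicator_of_notMem h, Set.indicator_of_notMem h, zero_mul]
  rw [key B hB, key Set.univ MeasurableSet.univ, measure_univ, mul_one]

theorem ae_tendsto_genTime_coord (hq : 0 < q) :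
    ∀ᵐ x ∂seqMeasure q, Tendsto (fun i => genTime coord i x) atTop atTop := by
  filter_upwards [ae_tendsto_genTime_div hq measurable_coord (iIndepFun_coord hq)
    (map_coord_seqMeasure hq)] with x hx
  exact tendsto_genTime_atTop hq hx

theorem mem_cycleEvent_iff {x : ℕ → ℝ} (htop : Tendsto (fun i => genTime coord i x) atTop atTop)
    {m : ℕ} {B : Set ℝ} : x ∈ cycleEvent θ m B ↔ m = firstTx θ x ∧ firstCycle θ x ∈ B := by
  have hspec := firstTx_spec (θ := θ) htop
  constructor
  · rintro ⟨h1, h2, h3⟩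
    have hm : m = firstTx θ x := by
      refine le_antisymm (not_lt.1 fun h => ?_) (not_lt.1 fun h => ?_)
      · exact absurd hspec.1 (not_lt.2 (h1 _ h))
      · exact absurd h3 (not_lt.2 (hspec.2 _ h))
    subst hm
    exact ⟨rfl, h2⟩
  · rintro ⟨rfl, h⟩
    exact ⟨hspec.2, h, hspec.1⟩

theorem disjoint_cycleEvent {B : Set ℝ} : Pairwise fun m n =>
    Disjoint (cycleEvent θ m B) (cycleEvent θ n B) := by
  intro m n hmn
  refine Set.disjoint_left.2 fun x hx hx' => ?_
  rcases lt_or_gt_of_ne hmn with h | h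
  · exact absurd hx.2.2 (not_lt.2 (hx'.1 m h))
  · exact absurd hx'.2.2 (not_lt.2 (hx.1 n h))

/-- The first cycle length is independent of what happens after the first cycle, and the latter is
distributed like the original sequence. -/
theorem seqMeasure_firstCycle_inter_nextCycle (hq : 0 < q) (hθ : 0 ≤ θ) {B : Set ℝ}
    (hB : MeasurableSet B) {A : Set (ℕ → ℝ)} (hA : MeasurableSet A) :
    seqMeasure q (firstCycle θ ⁻¹' B ∩ nextCycle θ ⁻¹' A) = cycleLaw q θ B * seqMeasure q A := by
  have := isProbabilityMeasure_seqMeasure hq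
  -- Almost surely exactly one packet ends the first cycle.
  have hone : ∑' m, seqMeasure q (cycleEvent θ m Set.univ) = 1 := by
    rw [← measure_iUnion disjoint_cycleEvent
      fun m => measurableSet_cycleEvent m MeasurableSet.univ, ← measure_univ (μ := seqMeasure q)]
    refine measure_congr ?_
    filter_upwards [ae_tendsto_genTime_coord hq] with x hx
    refine propext (iff_of_true ?_ trivial)
    exact Set.mem_iUnion.2 ⟨_, (mem_cycleEvent_iff hx).2 ⟨rfl, trivial⟩⟩
  have hae : (firstCycle θ ⁻¹' B ∩ nextCycle θ ⁻¹' A : Set (ℕ → ℝ)) =ᵐ[seqMeasure q]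
      ⋃ m, cycleEvent θ m B ∩ tail (m + 1) ⁻¹' A := by
    filter_upwards [ae_tendsto_genTime_coord hq] with x hx
    refine propext ?_
    change x ∈ (firstCycle θ ⁻¹' B ∩ nextCycle θ ⁻¹' A : Set (ℕ → ℝ)) ↔
      x ∈ ⋃ m, cycleEvent θ m B ∩ tail (m + 1) ⁻¹' A
    simp only [Set.mem_iUnion, Set.mem_inter_iff, mem_cycleEvent_iff hx, Set.mem_preimage]
    constructor
    · rintro ⟨h1, h2⟩
      exact ⟨_, ⟨rfl, h1⟩, h2⟩
    · rintro ⟨m, ⟨rfl, h1⟩, h2⟩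
      exact ⟨h1, h2⟩
  rw [measure_congr hae, measure_iUnion
    (fun m n hmn => (disjoint_cycleEvent hmn).mono Set.inter_subset_left Set.inter_subset_left)
    fun m => (measurableSet_cycleEvent m hB).inter (measurable_tail _ hA)]
  simp_rw [seqMeasure_cycleEvent_inter_tail hq _ hB hA, seqMeasure_cycleEvent hq hθ _ hB]
  rw [ENNReal.tsum_mul_right, ENNReal.tsum_mul_right, hone, one_mul]

theorem measurable_iterate_nextCycle (k : ℕ) : Measurable (nextCycle θ)^[k] :=
  measurable_nextCycle.iterate k

theorem seqMeasure_forall_firstCycle_mem (hq : 0 < q) (hθ : 0 ≤ θ) (n : ℕ) (B : ℕ → Set ℝ)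
    (hB : ∀ k, MeasurableSet (B k)) :
    seqMeasure q {x | ∀ k < n, firstCycle θ ((nextCycle θ)^[k] x) ∈ B k} =
      ∏ k ∈ Finset.range n, cycleLaw q θ (B k) := by
  have := isProbabilityMeasure_seqMeasure hq
  induction n generalizing B with
  | zero => simp
  | succ n ih =>
    have hset : {x : ℕ → ℝ | ∀ k < n + 1, firstCycle θ ((nextCycle θ)^[k] x) ∈ B k} =
        firstCycle θ ⁻¹' B 0 ∩ nextCycle θ ⁻¹'
          {x | ∀ k < n, firstCycle θ ((nextCycle θ)^[k] x) ∈ B (k + 1)} := by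
      ext x
      simp only [Set.mem_ofPred_eq, Set.mem_inter_iff, Set.mem_preimage]
      constructor
      · intro h
        exact ⟨h 0 n.succ_pos, fun k hk => h (k + 1) (by omega)⟩
      · rintro ⟨h0, h⟩ k hk
        cases k with
        | zero => exact h0
        | succ k => exact h k (by omega)
    have hA : MeasurableSet
        {x : ℕ → ℝ | ∀ k < n, firstCycle θ ((nextCycle θ)^[k] x) ∈ B (k + 1)} := by
      have h : {x : ℕ → ℝ | ∀ k < n, firstCycle θ ((nextCycle θ)^[k] x) ∈ B (k + 1)} =
          ⋂ k ∈ Set.Iio n, (fun x => firstCycle θ ((nextCycle θ)^[k] x)) ⁻¹' B (k + 1) := by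
        ext x; simp
      rw [h]
      exact MeasurableSet.biInter (Set.to_countable _) fun k _ =>
        (measurable_firstCycle.comp (measurable_iterate_nextCycle k)) (hB _)
    rw [hset, seqMeasure_firstCycle_inter_nextCycle hq hθ (hB 0) hA,
      ih (fun k => B (k + 1)) fun k => hB (k + 1), Finset.prod_range_succ', mul_comm]

/-- Indices missing from `S` get the whole line as their set, contributing a factor 1. -/
theorem seqMeasure_biInter_firstCycle (hq : 0 < q) (hθ : 0 ≤ θ) (S : Finset ℕ) (B : ℕ → Set ℝ)
    (hB : ∀ k ∈ S, MeasurableSet (B k)) :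
    seqMeasure q (⋂ k ∈ S, (fun x => firstCycle θ ((nextCycle θ)^[k] x)) ⁻¹' B k) =
      ∏ k ∈ S, cycleLaw q θ (B k) := by
  classical
  have := isProbabilityMeasure_cycleLaw (θ := θ) hq
  obtain ⟨n, hn⟩ := S.exists_nat_subset_range
  let B' : ℕ → Set ℝ := fun k => if k ∈ S then B k else Set.univ
  have hB' : ∀ k, MeasurableSet (B' k) := by
    intro k
    by_cases h : k ∈ S
    · simpa [B', h] using hB k h
    · simp [B', h]
  have hset : (⋂ k ∈ S, (fun x => firstCycle θ ((nextCycle θ)^[k] x)) ⁻¹' B k) =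
      {x | ∀ k < n, firstCycle θ ((nextCycle θ)^[k] x) ∈ B' k} := by
    ext x
    simp only [Set.mem_iInter, Set.mem_preimage, Set.mem_ofPred_eq, B']
    constructor
    · intro h k _
      by_cases hk : k ∈ S
      · simpa [hk] using h k hk
      · simp [hk]
    · intro h k hk
      simpa [hk] using h k (Finset.mem_range.1 (hn hk))
  rw [hset, seqMeasure_forall_firstCycle_mem hq hθ n B' hB']
  refine (Finset.prod_subset hn fun k _ hk => ?_).symm.trans ?_
  · simp [B', hk]
  · exact Finset.prod_congr rfl fun k hk => by simp [B', hk]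

end CycleLaw

/-! ### Transfer from sequence space to the given probability space; moments of the cycles -/

section Transfer

variable {Ω : Type*} [mΩ : MeasurableSpace Ω] {μ : Measure Ω} {X : ℕ → Ω → ℝ} {q θ : ℝ}

theorem cycleLength_eq_coord {Ω : Type*} {X : ℕ → Ω → ℝ} (n : ℕ) (ω : Ω) :
    cycleLength X (thresholdPolicy X θ) n ω =
      cycleLength coord (thresholdPolicy coord θ) n fun i => X i ω := by
  have hstart : ∀ i, thresholdStart X θ i ω = thresholdStart coord θ i fun i => X i ω := by
    intro i
    induction i with
    | zero => rfl
    | succ i ih => simp only [thresholdStart, ih]; rfl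
  have hpol : ∀ i, thresholdPolicy X θ i ω = thresholdPolicy coord θ i fun i => X i ω := by
    intro i
    simp only [thresholdPolicy, hstart]; rfl
  have hcs : ∀ n, cycleStart X (thresholdPolicy X θ) n ω =
      cycleStart coord (thresholdPolicy coord θ) n fun i => X i ω := by
    intro n
    cases n with
    | zero => rfl
    | succ n => simp only [cycleStart, hpol]; rfl
  simp only [cycleLength, hcs]

theorem map_eq_seqMeasure (hX : ∀ i, Measurable (X i)) (hX_indep : iIndepFun X μ)
    (hX_law : ∀ i, μ.map (X i) = expMeasure q) : μ.map (fun ω i => X i ω) = seqMeasure q := by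
  have h := hX_indep.map_fun_eq_infinitePi_map hX
  simp only [hX_law] at h
  exact h

/-- Supplies a measurable version of the cycle length, valid on the paths whose generation times
tend to infinity. -/
theorem ae_cycleLength_eq (hq : 0 < q) (hX : ∀ i, Measurable (X i)) (hX_indep : iIndepFun X μ)
    (hX_law : ∀ i, μ.map (X i) = expMeasure q) (n : ℕ) :
    (fun ω => firstCycle θ ((nextCycle θ)^[n] fun i => X i ω)) =ᵐ[μ]
      cycleLength X (thresholdPolicy X θ) n := by
  filter_upwards [ae_tendsto_genTime_div hq hX hX_indep hX_law] with ω hω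
  rw [cycleLength_eq_coord, cycleLength_eq_iterate]
  exact tendsto_genTime_atTop hq hω

theorem measurable_firstCycle_iterate (hX : ∀ i, Measurable (X i)) (n : ℕ) :
    Measurable fun ω => firstCycle θ ((nextCycle θ)^[n] fun i => X i ω) :=
  measurable_firstCycle.comp
    ((measurable_iterate_nextCycle n).comp (measurable_pi_iff.2 hX))

theorem measure_biInter_firstCycle (hq : 0 < q) (hθ : 0 ≤ θ) (hX : ∀ i, Measurable (X i))
    (hX_indep : iIndepFun X μ) (hX_law : ∀ i, μ.map (X i) = expMeasure q) (S : Finset ℕ)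
    (B : ℕ → Set ℝ) (hB : ∀ k ∈ S, MeasurableSet (B k)) :
    μ (⋂ k ∈ S, (fun ω => firstCycle θ ((nextCycle θ)^[k] fun i => X i ω)) ⁻¹' B k) =
      ∏ k ∈ S, cycleLaw q θ (B k) := by
  have hm : MeasurableSet
      (⋂ k ∈ S, (fun x => firstCycle θ ((nextCycle θ)^[k] x)) ⁻¹' B k) :=
    Finset.measurableSet_biInter S fun k hk =>
      (measurable_firstCycle.comp (measurable_iterate_nextCycle k)) (hB k hk)
  rw [← seqMeasure_biInter_firstCycle hq hθ S B hB, ← map_eq_seqMeasure hX hX_indep hX_law,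
    Measure.map_apply (measurable_pi_iff.2 hX) hm]
  simp only [Set.preimage_iInter]
  rfl

theorem map_cycleLength (hq : 0 < q) (hθ : 0 ≤ θ) (hX : ∀ i, Measurable (X i))
    (hX_indep : iIndepFun X μ) (hX_law : ∀ i, μ.map (X i) = expMeasure q) (n : ℕ) :
    μ.map (cycleLength X (thresholdPolicy X θ) n) = cycleLaw q θ := by
  rw [← Measure.map_congr (ae_cycleLength_eq hq hX hX_indep hX_law n)]
  refine Measure.ext fun B hB => ?_
  rw [Measure.map_apply (measurable_firstCycle_iterate hX n) hB]
  have h := measure_biInter_firstCycle (θ := θ) hq hθ hX hX_indep hX_law {n} (fun _ => B)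
    fun _ _ => hB
  simpa using h

theorem aemeasurable_cycleLength (hq : 0 < q) (hX : ∀ i, Measurable (X i))
    (hX_indep : iIndepFun X μ) (hX_law : ∀ i, μ.map (X i) = expMeasure q) (n : ℕ) :
    AEMeasurable (cycleLength X (thresholdPolicy X θ) n) μ :=
  (measurable_firstCycle_iterate hX n).aemeasurable.congr
    (ae_cycleLength_eq hq hX hX_indep hX_law n)

theorem iIndepFun_cycleLength (hq : 0 < q) (hθ : 0 ≤ θ) (hX : ∀ i, Measurable (X i))
    (hX_indep : iIndepFun X μ) (hX_law : ∀ i, μ.map (X i) = expMeasure q) :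
    iIndepFun (cycleLength X (thresholdPolicy X θ)) μ := by
  refine (iIndepFun_congr fun n => ae_cycleLength_eq hq hX hX_indep hX_law n).1 ?_
  rw [iIndepFun_iff_measure_inter_preimage_eq_mul]
  intro S B hB
  rw [measure_biInter_firstCycle hq hθ hX hX_indep hX_law S B hB]
  refine Finset.prod_congr rfl fun k hk => ?_
  rw [← map_cycleLength hq hθ hX hX_indep hX_law k,
    ← Measure.map_congr (ae_cycleLength_eq hq hX hX_indep hX_law k),
    Measure.map_apply (measurable_firstCycle_iterate hX k) (hB k hk)]

theorem memLp_id_cycleLaw (hq : 0 < q) : MemLp (fun x => x) 2 (cycleLaw q θ) := by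
  have := isProbabilityMeasure_expMeasure hq
  have hθm : Measurable fun y : ℝ => θ + y := by fun_prop
  refine (memLp_map_measure_iff (by fun_prop) hθm.aemeasurable).2 ?_
  have h : MemLp (fun y : ℝ => y) 2 (expMeasure q) :=
    (memLp_two_iff_integrable_sq (by fun_prop)).2 (integrable_pow_expMeasure hq 2)
  exact (memLp_const θ).add h

theorem integral_id_cycleLaw (hq : 0 < q) : ∫ x, x ∂cycleLaw q θ = θ + 1 / q := by
  have := isProbabilityMeasure_expMeasure hq
  have hθm : Measurable fun y : ℝ => θ + y := by fun_prop
  rw [cycleLaw, integral_map hθm.aemeasurable (by fun_prop),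
    integral_add (integrable_const _) (integrable_id_expMeasure hq), integral_id_expMeasure hq]
  simp

theorem integral_sq_cycleLaw (hq : 0 < q) :
    ∫ x, x ^ 2 ∂cycleLaw q θ = (θ + 1 / q) ^ 2 + 1 / q ^ 2 := by
  have := isProbabilityMeasure_expMeasure hq
  have hθm : Measurable fun y : ℝ => θ + y := by fun_prop
  rw [cycleLaw, integral_map hθm.aemeasurable (by fun_prop)]
  have h : ∀ y : ℝ, (θ + y) ^ 2 = (θ ^ 2 + 2 * θ * y) + y ^ 2 := fun y => by ring
  simp_rw [h]
  have h1 : Integrable (fun y : ℝ => 2 * θ * y) (expMeasure q) :=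
    (integrable_id_expMeasure hq).const_mul _
  have h2 : Integrable (fun y : ℝ => θ ^ 2 + 2 * θ * y) (expMeasure q) :=
    (integrable_const _).add h1
  rw [integral_add h2 (integrable_pow_expMeasure hq 2), integral_add (integrable_const _) h1,
    integral_const_mul, integral_id_expMeasure hq, integral_sq_expMeasure hq]
  simp
  field_simp
  ring

section Moments

variable (hq : 0 < q) (hθ : 0 ≤ θ) (hX : ∀ i, Measurable (X i)) (hX_indep : iIndepFun X μ)
  (hX_law : ∀ i, μ.map (X i) = expMeasure q)

include hq hθ hX hX_indep hX_law

theorem memLp_cycleLength (n : ℕ) : MemLp (cycleLength X (thresholdPolicy X θ) n) 2 μ := by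
  have h := memLp_id_cycleLaw (θ := θ) hq
  rw [← map_cycleLength hq hθ hX hX_indep hX_law n] at h
  exact h.comp_of_map (aemeasurable_cycleLength hq hX hX_indep hX_law n)

theorem integral_cycleLength (n : ℕ) :
    ∫ ω, cycleLength X (thresholdPolicy X θ) n ω ∂μ = θ + 1 / q := by
  rw [← integral_id_cycleLaw hq, ← map_cycleLength hq hθ hX hX_indep hX_law n,
    integral_map (aemeasurable_cycleLength hq hX hX_indep hX_law n) (by fun_prop)]

theorem integral_sq_cycleLength (n : ℕ) :
    ∫ ω, cycleLength X (thresholdPolicy X θ) n ω ^ 2 ∂μ = (θ + 1 / q) ^ 2 + 1 / q ^ 2 := by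
  rw [← integral_sq_cycleLaw hq, ← map_cycleLength hq hθ hX hX_indep hX_law n,
    integral_map (aemeasurable_cycleLength hq hX hX_indep hX_law n) (by fun_prop)]

end Moments

end Transfer

theorem isStationaryNB_thresholdPolicy {Ω : Type*} {𝓡 : MeasurableSpace Ω}
    [mΩ : MeasurableSpace Ω] {h𝓡 : 𝓡 ≤ mΩ} {μ : Measure Ω} [IsProbabilityMeasure μ]
    {X : ℕ → Ω → ℝ} {q θ : ℝ} (hq : 0 < q) (hθ : 0 ≤ θ) {hX : ∀ i, Measurable (X i)}
    (hX0 : ∀ i ω, 0 ≤ X i ω) (hX_indep : iIndepFun X μ)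
    (hX_law : ∀ i, μ.map (X i) = expMeasure q) :
    IsStationaryNB 𝓡 h𝓡 μ X hX (thresholdPolicy X θ) where
  causal := isCausal_thresholdPolicy hX0
  nonBuffering := isNonBuffering_thresholdPolicy
  cycles_finite := by
    filter_upwards [ae_tendsto_genTime_div hq hX hX_indep hX_law] with ω hω
    exact infinite_transmitted_thresholdPolicy (tendsto_genTime_atTop hq hω)
  indep := iIndepFun_cycleLength hq hθ hX hX_indep hX_law
  identDistrib n := ⟨aemeasurable_cycleLength hq hX hX_indep hX_law n,
    aemeasurable_cycleLength hq hX hX_indep hX_law 0, by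
      rw [map_cycleLength hq hθ hX hX_indep hX_law n, map_cycleLength hq hθ hX hX_indep hX_law 0]⟩
  integrable := (memLp_cycleLength hq hθ hX hX_indep hX_law 0).integrable one_le_two

/-! ### Algebra of the optimal threshold -/

section Threshold

variable {q ρ c : ℝ}

theorem optThreshold_add (q ρ c : ℝ) :
    Real.sqrt (1 / q ^ 2 + 2 * (ρ * c)) = optThreshold q ρ c + 1 / q := by
  unfold optThreshold; ring

theorem optThreshold_nonneg (hρc : 0 ≤ ρ * c) : 0 ≤ optThreshold q ρ c := by
  refine sub_nonneg.2 (Real.le_sqrt_of_sq_le ?_)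
  rw [one_div_pow]
  linarith

/-- The indifference condition κ = V(θ): at age θ, a transmission costs exactly the value of
resetting the age to 0. -/
theorem mul_eq_optThreshold (hρc : 0 ≤ ρ * c) :
    ρ * c = Real.sqrt (1 / q ^ 2 + 2 * (ρ * c)) * optThreshold q ρ c -
      optThreshold q ρ c ^ 2 / 2 := by
  have h := Real.sq_sqrt (show 0 ≤ 1 / q ^ 2 + 2 * (ρ * c) by positivity)
  have h2 : (1 / q) ^ 2 = 1 / q ^ 2 := one_div_pow q 2
  unfold optThreshold
  nlinarith

end Threshold

end AoI

/-! ### The main theorem -/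

theorem mainTheorem1 {Ω : Type*} (𝓡 : MeasurableSpace Ω)
    [mΩ : MeasurableSpace Ω] (h𝓡 : 𝓡 ≤ mΩ) (μ : Measure Ω) [IsProbabilityMeasure μ]
    (q ρ c : ℝ) (hq : 0 < q) (hρ : 0 ≤ ρ) (hc : 0 ≤ c)
    (X : ℕ → Ω → ℝ) (hX : ∀ i, Measurable (X i)) (hX_nonneg : ∀ i ω, 0 ≤ X i ω)
    (hX_indep : iIndepFun X μ) (hX_law : ∀ i, μ.map (X i) = expMeasure q)
    (h𝓡_indep : Indep 𝓡 (⨆ i, MeasurableSpace.comap (X i) inferInstance) μ) :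
    0 ≤ AoI.optThreshold q ρ c ∧
    -- the threshold policy is causal, non-buffering, with i.i.d. integrable cycle lengths
    AoI.IsStationaryNB 𝓡 h𝓡 μ X hX (AoI.thresholdPolicy X (AoI.optThreshold q ρ c)) ∧
    -- its long-run average cost
    (∀ᵐ ω ∂μ, Tendsto
      (fun t : ℝ => AoI.totalCost ρ c X (AoI.thresholdPolicy X (AoI.optThreshold q ρ c)) t ω)
      atTop (𝓝 (Real.sqrt (1 / q ^ 2 + 2 * (ρ * c))))) ∧
    -- no causal policy does better
    (∀ r : ℕ → Ω → WithTop ℝ, AoI.IsCausal 𝓡 h𝓡 X hX r →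
      ∀ᵐ ω ∂μ, ((Real.sqrt (1 / q ^ 2 + 2 * (ρ * c)) : ℝ) : EReal) ≤
        liminf (fun t : ℝ => ((AoI.totalCost ρ c X r t ω : ℝ) : EReal)) atTop) ∧
    -- mean and variance of its cycle lengths
    (∀ n, MemLp
        (AoI.cycleLength X (AoI.thresholdPolicy X (AoI.optThreshold q ρ c)) n) 2 μ ∧
      ∫ ω, AoI.cycleLength X (AoI.thresholdPolicy X (AoI.optThreshold q ρ c)) n ω ∂μ =
        Real.sqrt (1 / q ^ 2 + 2 * (ρ * c)) ∧
      variance (AoI.cycleLength X (AoI.thresholdPolicy X (AoI.optThreshold q ρ c)) n) μ =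
        1 / q ^ 2) ∧
    -- it minimizes the cycle cost among the stationary non-buffering policies
    AoI.cycleCost μ ρ c X (AoI.thresholdPolicy X (AoI.optThreshold q ρ c)) =
      ENNReal.ofReal (Real.sqrt (1 / q ^ 2 + 2 * (ρ * c))) ∧
    (∀ r : ℕ → Ω → WithTop ℝ, AoI.IsStationaryNB 𝓡 h𝓡 μ X hX r →
      AoI.cycleCost μ ρ c X (AoI.thresholdPolicy X (AoI.optThreshold q ρ c)) ≤
        AoI.cycleCost μ ρ c X r) := by
  have hρc : 0 ≤ ρ * c := mul_nonneg hρ hc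
  have hθ := AoI.optThreshold_nonneg (q := q) hρc
  have hβ := AoI.optThreshold_add q ρ c
  have hκ := AoI.mul_eq_optThreshold (q := q) hρc
  have hstat := AoI.isStationaryNB_thresholdPolicy (h𝓡 := h𝓡) (hX := hX) hq hθ hX_nonneg hX_indep
    hX_law
  set θ := AoI.optThreshold q ρ c
  set β := Real.sqrt (1 / q ^ 2 + 2 * (ρ * c)) with hβdef
  have hβpos : 0 < β := by rw [hβ]; positivity
  have hβsq : β ^ 2 = 1 / q ^ 2 + 2 * (ρ * c) := Real.sq_sqrt (by positivity)
  have hmem := AoI.memLp_cycleLength hq hθ hX hX_indep hX_law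
  have hmean : ∀ n, ∫ ω, AoI.cycleLength X (AoI.thresholdPolicy X θ) n ω ∂μ = β := fun n => by
    rw [AoI.integral_cycleLength hq hθ hX hX_indep hX_law, hβ]
  have hsq : ∀ n, ∫ ω, AoI.cycleLength X (AoI.thresholdPolicy X θ) n ω ^ 2 ∂μ =
      β ^ 2 + 1 / q ^ 2 := fun n => by
    rw [AoI.integral_sq_cycleLength hq hθ hX hX_indep hX_law, hβ]
  have hlower := fun r hr => AoI.ae_le_liminf_totalCost (h𝓡 := h𝓡) (hX := hX) (r := r) hq hθ hβ hκ
    hX_nonneg hX_indep hX_law h𝓡_indep hr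
  -- Since β² = 1/q² + 2ρc, the numerator ρc + (β² + 1/q²)/2 equals β².
  have hvalue : (ρ * c + (∫ ω, AoI.cycleLength X (AoI.thresholdPolicy X θ) 0 ω ^ 2 ∂μ) / 2) /
      (∫ ω, AoI.cycleLength X (AoI.thresholdPolicy X θ) 0 ω ∂μ) = β := by
    rw [hsq, hmean, div_eq_iff hβpos.ne']
    linarith
  have hcost : AoI.cycleCost μ ρ c X (AoI.thresholdPolicy X θ) = ENNReal.ofReal β := by
    rw [AoI.cycleCost_eq_ofReal hρc (hmem 0) (by rw [hmean]; exact hβpos), hvalue]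
  refine ⟨hθ, hstat, ?_, hlower, fun n => ⟨hmem n, hmean n, ?_⟩, hcost, fun r hr => ?_⟩
  · have hupper := AoI.ae_eventually_totalCost_lt hq hρc hX_nonneg hX_indep hX_law hstat (hmem 0)
    rw [hvalue] at hupper
    -- The limit is squeezed between the bound for all causal policies and the renewal-reward bound.
    filter_upwards [hlower _ hstat.causal, hupper] with ω h1 h2
    refine tendsto_order.2 ⟨fun b hb => ?_, fun b hb => h2 b hb⟩
    filter_upwards [eventually_lt_of_lt_liminf ((EReal.coe_lt_coe_iff.2 hb).trans_le h1)] with t ht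
    exact EReal.coe_lt_coe_iff.1 ht
  · have h := variance_eq_sub (hmem n)
    simp only [Pi.pow_apply] at h
    rw [h, hsq, hmean]
    ring
  · rw [hcost]
    exact AoI.ofReal_le_cycleCost hq hθ hβ hκ hX_nonneg hX_indep hX_law h𝓡_indep hr
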